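/- Let $J\ge 1$, $\boldsymbol\alpha=(\alpha_1,\dots,\alpha_J)$ with all $\alpha_k>0$ fixed, and $\theta_0\in\mathbb R$. An item of the generalized partial credit model with thresholds $\boldsymbol\tau\in\mathbb R^J$ has responses $Y\in\{0,\dots,J\}$ with probabilities $$\pi_j(\theta,\boldsymbol\tau)=\frac{\exp\big(\sum_{s=1}^{j}\alpha_s(\theta-\tau_s)\big)}{\sum_{k=0}^{J}\exp\big(\sum_{s=1}^{k}\alpha_s(\theta-\tau_s)\big)},$$ and Fisher information $M(\theta,\boldsymbol\tau)=\operatorname{Var}\big[\tfrac{d}{d\theta}\log \pi_Y(\theta,\boldsymbol\tau)\big]$. Let $\boldsymbol\tau^*$ be the (ideal) limit item $\boldsymbol\tau^*=\lim_{c\to\infty}(\theta_0+\alpha_Jc,\theta_0,\dots,\theta_0,\theta_0-\alpha_1c)$ (for $J=1$, $\boldsymbol\tau^*=\theta_0$), with $\pi_j(\theta,\boldsymbol\tau^*)$ and $M(\theta,\boldsymbol\tau^*)$ defined as the corresponding pointwise limits. A design $\xi$ puts nonnegative weights $w_i$ with sum $1$ on finitely many points $x_i$ of the region $\mathbb R^J\cup\{\boldsymbol\tau^*\}$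 and has information $M(\theta,\xi)=\sum_i w_iM(\theta,x_i)$. For a weight distribution $\Pi$ of $\theta$ put $\psi_0(\xi)=\int\log M(\theta,\xi)\,d\Pi$ and $\psi_{-1}(\xi)=-\int M(\theta,\xi)^{-1}\,d\Pi$; the one-point design $\boldsymbol\tau^*$ is Bayes optimal with respect to $\psi_0$ if $\psi_0(\boldsymbol\tau^*)$ is finite and $\psi_0(\xi)\le\psi_0(\boldsymbol\tau^*)$ for all designs $\xi$. Let $(\Pi_s)_{s>0}$ be a scale family of symmetric distributions around $\theta_0$: $\Pi_s$ is the distribution of $\theta_0+sZ$, where $Z$ is a real random variable whose distribution is symmetric about $0$. (a) There exist unique $s_{-1},s_0\in[0,\infty]$ such that, for all $s>0$, $$\int \frac{1}{\pi_J(\theta,\boldsymbol\tau^*)\,\pi_0(\theta,\boldsymbol\tau^*)}\,d\Pi_s\le 6\iff s\le s_{-1},\qquad \int \pi_J(\theta,\boldsymbol\tau^*)\,\pi_0(\theta,\boldsymbol\tau^*)\,d\Pi_s\ge\tfrac16\iff s\le s_0 .$$ They satisfy $s_{-1}\le s_0$ and $0<s_0\le\infty$; and $0<s_{-1}$ provided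 that $\psi_{-1}(\boldsymbol\tau^*)$ is finite under $\Pi_s$ for at least one $s>0$. (b) There exists a unique $\tilde s_0\in[0,\infty]$ such that, for all $s>0$, the one-point design $\boldsymbol\tau^*$ is Bayes optimal with respect to $\psi_0$ under $\Pi_s$ if and only if $s\le\tilde s_0$. It satisfies $0\le\tilde s_0\le s_0$, and $\tilde s_0<\infty$ unless $Z=0$ almost surely. -/

import Mathlib

open MeasureTheory Filter Topology
open scoped ENNReal

noncomputable section

namespace GPCM

variable {J : ℕ}

/-- The linear predictor `∑_{s=1}^{j} α_s (θ - τ_s)` of category `j` (zero for `j = 0`).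
The step numbered `s = 1, …, J` is the index `s - 1` of `Fin J`. -/
def linPred (α τ : Fin J → ℝ) (θ : ℝ) (j : ℕ) : ℝ :=
  ∑ s ∈ Finset.univ.filter (fun s : Fin J => (s : ℕ) < j), α s * (θ - τ s)

/-- The probability `π_j(θ, τ, α)` of the response `j ∈ {0, …, J}`. -/
def prob (α τ : Fin J → ℝ) (j : Fin (J + 1)) (θ : ℝ) : ℝ :=
  Real.exp (linPred α τ θ j) / ∑ k : Fin (J + 1), Real.exp (linPred α τ θ k)

/-- The score `d/dθ log f(Y; θ, τ, α)` at the response `Y = j`. -/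
def score (α τ : Fin J → ℝ) (j : Fin (J + 1)) (θ : ℝ) : ℝ :=
  deriv (fun t => Real.log (prob α τ j t)) θ

/-- The Fisher information `M(θ, τ, α)` of a single item: the variance of the score, where the
response `Y` has the distribution `(π_0, …, π_J)`. -/
def fisherInfo (α τ : Fin J → ℝ) (θ : ℝ) : ℝ :=
  ∑ j, prob α τ j θ * (score α τ j θ) ^ 2 - (∑ j, prob α τ j θ * score α τ j θ) ^ 2

variable [NeZero J]

/-- The threshold vector `(θ₀ + α_J c, θ₀, …, θ₀, θ₀ - α_1 c)`. For `J = 1` the first and the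
last entry coincide and the vector is `(θ₀)`. -/
def tauSeq (α : Fin J → ℝ) (θ₀ c : ℝ) (k : Fin J) : ℝ :=
  θ₀ + (if k = 0 then α (Fin.rev 0) * c else 0) - (if k = Fin.rev 0 then α 0 * c else 0)

/-- The response probabilities `π_j(θ, τ*, α)` at the limit design
`τ* = lim_{c → ∞} (θ₀ + α_J c, θ₀, …, θ₀, θ₀ - α_1 c)`. For positive `α` this limit exists: with
`A = α_1 + … + α_J` it is `exp (A (θ - θ₀)) / (1 + exp (A (θ - θ₀)))` for `j = J`,
`1 / (1 + exp (A (θ - θ₀)))` for `j = 0`, and `0` otherwise. -/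
def probStar (α : Fin J → ℝ) (θ₀ : ℝ) (j : Fin (J + 1)) (θ : ℝ) : ℝ :=
  limUnder atTop (fun c : ℝ => prob α (tauSeq α θ₀ c) j θ)

/-- The Fisher information `M(θ, τ*, α)` at the limit design `τ*`. For positive `α` the limit
exists and equals `(α_1 + … + α_J)² π_J π_0`, with `π_J`, `π_0` taken at `τ*`. -/
def fisherInfoStar (α : Fin J → ℝ) (θ₀ : ℝ) (θ : ℝ) : ℝ :=
  limUnder atTop (fun c : ℝ => fisherInfo α (tauSeq α θ₀ c) θ)

/-- The design region for fixed discriminations: all threshold vectors in `ℝ^J`, together with the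
limit design `τ*`. -/
inductive DesignPoint (J : ℕ) : Type
  | item (τ : Fin J → ℝ) : DesignPoint J
  | star : DesignPoint J

/-- The Fisher information of a single point of the design region. -/
def pointInfo (α : Fin J → ℝ) (θ₀ : ℝ) : DesignPoint J → ℝ → ℝ
  | .item τ, θ => fisherInfo α τ θ
  | .star, θ => fisherInfoStar α θ₀ θ

/-- An approximate design: finitely many design points with nonnegative weights of sum one. -/
structure Design (J : ℕ) where
  weight : DesignPoint J →₀ ℝ
  nonneg : ∀ x, 0 ≤ weight x
  sum_one : weight.sum (fun _ w => w) = 1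

/-- The one-point design at `τ*`. -/
def starDesign (J : ℕ) : Design J where
  weight := Finsupp.single .star 1
  nonneg x := by
    classical
    rw [Finsupp.single_apply]
    split_ifs <;> norm_num
  sum_one := by simp

/-- The (normalized) Fisher information `M(θ, ξ)` of a design, additive over its items. -/
def designInfo (α : Fin J → ℝ) (θ₀ : ℝ) (ξ : Design J) (θ : ℝ) : ℝ :=
  ξ.weight.sum (fun x w => w * pointInfo α θ₀ x θ)

/-- The Bayesian criterion `ψ_0(ξ) = E[log M(θ, ξ)]` for the weight distribution `μ` of `θ`. -/
def psi0 (α : Fin J → ℝ) (θ₀ : ℝ) (μ : Measure ℝ) (ξ : Design J) : ℝ :=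
  ∫ θ, Real.log (designInfo α θ₀ ξ θ) ∂μ

/-- `ξ` is Bayes optimal with respect to `ψ_0`: it has a finite criterion value, which no design
exceeds. Since the information is bounded above, a design for which `log M(θ, ξ)` is not
integrable has the criterion value `-∞`, so that only integrable competitors matter. -/
def IsBayesOptimal0 (α : Fin J → ℝ) (θ₀ : ℝ) (μ : Measure ℝ) (ξ : Design J) : Prop :=
  Integrable (fun θ => Real.log (designInfo α θ₀ ξ θ)) μ ∧
    ∀ η : Design J, Integrable (fun θ => Real.log (designInfo α θ₀ η θ)) μ →
      psi0 α θ₀ μ η ≤ psi0 α θ₀ μ ξ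

/-- The necessary condition for `ψ_0`: `∫ π_J π_0 dμ ≥ 1/6` at `τ*`. -/
def NecessaryCond0 (α : Fin J → ℝ) (θ₀ : ℝ) (μ : Measure ℝ) : Prop :=
  1 / 6 ≤ ∫ θ, probStar α θ₀ (Fin.last J) θ * probStar α θ₀ 0 θ ∂μ

/-- The necessary condition for `ψ_{-1}`: `∫ (π_J π_0)⁻¹ dμ ≤ 6` at `τ*`; in particular the
integral is finite. -/
def NecessaryCondM1 (α : Fin J → ℝ) (θ₀ : ℝ) (μ : Measure ℝ) : Prop :=
  Integrable (fun θ => (probStar α θ₀ (Fin.last J) θ * probStar α θ₀ 0 θ)⁻¹) μ ∧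
    ∫ θ, (probStar α θ₀ (Fin.last J) θ * probStar α θ₀ 0 θ)⁻¹ ∂μ ≤ 6

/-- The member with scale `s` of the scale family around `θ₀` generated by `P`: the distribution
of `θ₀ + s Z` where `Z` has the distribution `P`. -/
def scaleFamily (P : Measure ℝ) (θ₀ s : ℝ) : Measure ℝ :=
  P.map (fun z => θ₀ + s * z)

/-- `x ∈ [0, ∞]` is the threshold of a property of the scale `s > 0`: the property holds exactly
for `s ≤ x`. -/
def IsThreshold (C : ℝ → Prop) (x : ℝ≥0∞) : Prop :=
  ∀ s : ℝ, 0 < s → (C s ↔ ENNReal.ofReal s ≤ x)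

end GPCM

end

open GPCM

/-!
Write `A = α_1 + … + α_J` and `x = θ - θ₀`. The score at the response `j` is
`α_1 + … + α_j` minus its expectation, so the information of an item is a variance. At the limit
design only the responses `0` and `J` survive; there `π_J π_0 = (2 (1 + cosh (A x)))⁻¹` (`starVar`)
and `M⋆ = A² π_J π_0`.

*Thresholds.* Every condition in question has the form `∫ F (s z) dP ≤ K`, with `F` nonnegative and
continuous. As `P` is symmetric, such an integral is nondecreasing in `s` as soon as
`F x + F (-x)` increases on `[0, ∞)`, and by Fatou's lemma a bound that holds for all smaller scales
holds at `s` (`exists_isThreshold_lintegral`). For the two necessary conditions `F` is an explicit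
function of `cosh (A x)`. They are compared through the tangent of `v ↦ 1 / v` at `v = 1 / 6`, and
dominated convergence as `s → 0` makes the thresholds positive.

*Bayes optimality.* By concavity of the logarithm the limit design is optimal if and only if its
criterion value is finite and `∫ M(θ, τ) / M⋆(θ) dΠ_s ≤ 1` for every item `τ`
(`isBayesOptimal0_iff`); finiteness means that `P` has a first moment, which does not involve `s`.
The monotonicity in `s` comes from the fact that `M(θ, τ) / M⋆(θ)` is a convex function of
`tanh (A x / 2)` (`monotoneOn_relInfo_symm`). Since the derivatives of the variance in `θ` are the
third and the fourth cumulant, this convexity amounts to `3 κ₃² ≤ A² κ₂² + 2 κ₂ κ₄`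
(`cumulant_ineq`), which follows from Pearson's inequality `μ₄ μ₂ ≥ μ₃² + μ₂³` and the sharpened
Popoviciu inequality `μ₃² + 4 μ₂³ ≤ A² μ₂²` for a variable with range in an interval of length `A`.

*Location of the optimality threshold.* The limit design around `θ₀ + t` is itself a limit of items.
Optimality at `s` therefore gives `∫ shiftRel T (cosh (A s z)) dP ≤ 1` for all `T = cosh (A t) ≥ 1`
(`lintegral_shiftRel_le`). The expansion at `T = 1` is the necessary condition
`∫ π_J π_0 dΠ_s ≥ 1 / 6`; a large `T` together with a large `s` contradicts the inequality unless
`Z = 0` almost surely.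
-/

namespace GPCM

section

variable {J : ℕ}

/-! ### Moments of the response distribution -/

/-- The coefficient `α_1 + … + α_j` of `θ` in the linear predictor of category `j`. -/
noncomputable def cumDisc (α : Fin J → ℝ) (j : ℕ) : ℝ :=
  ∑ s ∈ Finset.univ.filter (fun s : Fin J => (s : ℕ) < j), α s

/-- The expectation of `α_1 + … + α_Y` for a response `Y` to the item `τ`. -/
noncomputable def meanDisc (α τ : Fin J → ℝ) (θ : ℝ) : ℝ :=
  ∑ j : Fin (J + 1), prob α τ j θ * cumDisc α j

/-- The `k`-th central moment of `α_1 + … + α_Y` for a response `Y` to the item `τ`. -/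
noncomputable def centralMoment (α τ : Fin J → ℝ) (k : ℕ) (θ : ℝ) : ℝ :=
  ∑ j : Fin (J + 1), prob α τ j θ * (cumDisc α j - meanDisc α τ θ) ^ k

lemma cumDisc_zero (α : Fin J → ℝ) : cumDisc α 0 = 0 := by simp [cumDisc]

lemma cumDisc_last (α : Fin J → ℝ) : cumDisc α J = ∑ s, α s := by
  simp [cumDisc]

lemma cumDisc_nonneg {α : Fin J → ℝ} (hα : ∀ k, 0 < α k) (j : ℕ) : 0 ≤ cumDisc α j :=
  Finset.sum_nonneg fun s _ => (hα s).le

lemma cumDisc_le {α : Fin J → ℝ} (hα : ∀ k, 0 < α k) (j : ℕ) : cumDisc α j ≤ ∑ s, α s :=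
  Finset.sum_le_sum_of_subset_of_nonneg (Finset.filter_subset _ _) fun s _ _ => (hα s).le

lemma hasDerivAt_linPred (α τ : Fin J → ℝ) (j : ℕ) (θ : ℝ) :
    HasDerivAt (fun t => linPred α τ t j) (cumDisc α j) θ := by
  unfold linPred cumDisc
  refine HasDerivAt.fun_sum fun s _ => ?_
  simpa using ((hasDerivAt_id θ).sub_const (τ s)).const_mul (α s)

lemma sum_exp_linPred_pos (α τ : Fin J → ℝ) (θ : ℝ) :
    0 < ∑ k : Fin (J + 1), Real.exp (linPred α τ θ k) :=
  Finset.sum_pos (fun _ _ => Real.exp_pos _) Finset.univ_nonempty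

lemma prob_pos (α τ : Fin J → ℝ) (j : Fin (J + 1)) (θ : ℝ) : 0 < prob α τ j θ :=
  div_pos (Real.exp_pos _) (sum_exp_linPred_pos α τ θ)

lemma sum_prob (α τ : Fin J → ℝ) (θ : ℝ) : ∑ j : Fin (J + 1), prob α τ j θ = 1 := by
  unfold prob
  rw [← Finset.sum_div, div_self (sum_exp_linPred_pos α τ θ).ne']

lemma hasDerivAt_prob (α τ : Fin J → ℝ) (j : Fin (J + 1)) (θ : ℝ) :
    HasDerivAt (prob α τ j) (prob α τ j θ * (cumDisc α j - meanDisc α τ θ)) θ := by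
  have hS := sum_exp_linPred_pos α τ θ
  have h := ((hasDerivAt_linPred α τ j θ).exp).div
    (HasDerivAt.fun_sum (u := Finset.univ) fun (k : Fin (J + 1)) _ =>
      (hasDerivAt_linPred α τ k θ).exp) hS.ne'
  refine h.congr_deriv ?_
  have hm : meanDisc α τ θ = (∑ k : Fin (J + 1), Real.exp (linPred α τ θ k) * cumDisc α k) /
      ∑ k : Fin (J + 1), Real.exp (linPred α τ θ k) := by
    unfold meanDisc prob
    rw [Finset.sum_div]
    exact Finset.sum_congr rfl fun k _ => by ring
  rw [hm]
  unfold prob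
  field_simp

lemma score_eq (α τ : Fin J → ℝ) (j : Fin (J + 1)) (θ : ℝ) :
    score α τ j θ = cumDisc α j - meanDisc α τ θ := by
  unfold score
  rw [((hasDerivAt_prob α τ j θ).log (prob_pos α τ j θ).ne').deriv]
  field_simp [(prob_pos α τ j θ).ne']

lemma centralMoment_one (α τ : Fin J → ℝ) (θ : ℝ) : centralMoment α τ 1 θ = 0 := by
  simp only [centralMoment, pow_one, mul_sub, Finset.sum_sub_distrib, ← Finset.sum_mul, sum_prob]
  simp [meanDisc]

lemma fisherInfo_eq (α τ : Fin J → ℝ) (θ : ℝ) : fisherInfo α τ θ = centralMoment α τ 2 θ := by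
  have h := centralMoment_one α τ θ
  simp only [centralMoment, pow_one] at h
  simp only [fisherInfo, score_eq, h, centralMoment]
  ring

lemma fisherInfo_eq_sub (α τ : Fin J → ℝ) (θ : ℝ) :
    fisherInfo α τ θ = ∑ j : Fin (J + 1), prob α τ j θ * cumDisc α j ^ 2 -
      (∑ j : Fin (J + 1), prob α τ j θ * cumDisc α j) ^ 2 := by
  rw [fisherInfo_eq, centralMoment]
  have h : ∀ j : Fin (J + 1), prob α τ j θ * (cumDisc α j - meanDisc α τ θ) ^ 2 =
      prob α τ j θ * cumDisc α j ^ 2 - 2 * meanDisc α τ θ * (prob α τ j θ * cumDisc α j) +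
        meanDisc α τ θ ^ 2 * prob α τ j θ := fun j => by ring
  simp only [h, Finset.sum_add_distrib, Finset.sum_sub_distrib, ← Finset.mul_sum, sum_prob]
  simp only [meanDisc]
  ring

lemma hasDerivAt_meanDisc (α τ : Fin J → ℝ) (θ : ℝ) :
    HasDerivAt (meanDisc α τ) (centralMoment α τ 2 θ) θ := by
  unfold meanDisc
  refine (HasDerivAt.fun_sum (u := Finset.univ) fun (k : Fin (J + 1)) _ =>
    (hasDerivAt_prob α τ k θ).mul_const _).congr_deriv ?_
  have h := centralMoment_one α τ θ
  simp only [centralMoment, pow_one] at h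
  rw [← sub_zero (∑ k : Fin (J + 1), _), ← mul_zero (meanDisc α τ θ), ← h, Finset.mul_sum,
    ← Finset.sum_sub_distrib]
  exact Finset.sum_congr rfl fun k _ => by ring

lemma hasDerivAt_centralMoment (α τ : Fin J → ℝ) (k : ℕ) (θ : ℝ) :
    HasDerivAt (centralMoment α τ (k + 1))
      (centralMoment α τ (k + 2) θ - (k + 1) * centralMoment α τ 2 θ * centralMoment α τ k θ) θ := by
  unfold centralMoment
  refine (HasDerivAt.fun_sum (u := Finset.univ) fun (i : Fin (J + 1)) _ =>
    (hasDerivAt_prob α τ i θ).mul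
      (((hasDerivAt_meanDisc α τ θ).const_sub (cumDisc α i)).fun_pow (k + 1))).congr_deriv ?_
  rw [Finset.mul_sum, ← Finset.sum_sub_distrib]
  refine Finset.sum_congr rfl fun i _ => ?_
  simp only [centralMoment, Nat.add_sub_cancel]
  push_cast
  ring

lemma continuous_fisherInfo (α τ : Fin J → ℝ) : Continuous (fisherInfo α τ) := by
  rw [funext (fisherInfo_eq α τ)]
  exact continuous_iff_continuousAt.2 fun θ => (hasDerivAt_centralMoment α τ 1 θ).continuousAt

/-! ### Moment inequalities -/

/-- Pearson's inequality between skewness and kurtosis: the Gram matrix of `1, X, X²` is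
positive semidefinite. -/
lemma pearson_ineq {ι : Type*} [Fintype ι] {p X : ι → ℝ} (hp : ∀ i, 0 ≤ p i)
    (h0 : ∑ i, p i = 1) (h1 : ∑ i, p i * X i = 0) :
    (∑ i, p i * X i ^ 3) ^ 2 + (∑ i, p i * X i ^ 2) ^ 3 ≤
      (∑ i, p i * X i ^ 4) * ∑ i, p i * X i ^ 2 := by
  set m2 := ∑ i, p i * X i ^ 2 with hm2
  set m3 := ∑ i, p i * X i ^ 3 with hm3
  set m4 := ∑ i, p i * X i ^ 4 with hm4
  have hm2' : 0 ≤ m2 := Finset.sum_nonneg fun i _ => mul_nonneg (hp i) (sq_nonneg _)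
  have h := Finset.sum_nonneg fun i (_ : i ∈ Finset.univ) =>
    mul_nonneg (hp i) (sq_nonneg (m2 * X i ^ 2 - m3 * X i - m2 ^ 2))
  have e : ∀ i, p i * (m2 * X i ^ 2 - m3 * X i - m2 ^ 2) ^ 2 =
      m2 ^ 2 * (p i * X i ^ 4) - 2 * m2 * m3 * (p i * X i ^ 3) + (m3 ^ 2 - 2 * m2 ^ 3) *
        (p i * X i ^ 2) + 2 * m3 * m2 ^ 2 * (p i * X i) + m2 ^ 4 * p i := fun i => by ring
  simp only [e, Finset.sum_add_distrib, Finset.sum_sub_distrib, ← Finset.mul_sum, h0, h1,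
    ← hm2, ← hm3, ← hm4] at h
  rcases hm2'.eq_or_lt with h2 | h2
  · -- a vanishing variance forces `p i * X i = 0` throughout
    have hz := (Finset.sum_eq_zero_iff_of_nonneg
      fun i _ => mul_nonneg (hp i) (sq_nonneg (X i))).1 h2.symm
    have h3 : m3 = 0 := Finset.sum_eq_zero fun i hi => by
      have := hz i hi
      linear_combination X i * this
    rw [← h2, h3]
    simp
  · have : 0 ≤ m2 * (m4 * m2 - m3 ^ 2 - m2 ^ 3) := by nlinarith
    have := nonneg_of_mul_nonneg_right this h2
    linarith

/-- A sharpening of Popoviciu's inequality `4 Var X ≤ A²` by a skewness term, for a centred `X`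
with values in an interval `[-l, r]` of length `A = l + r`. -/
lemma popoviciu_skew {ι : Type*} [Fintype ι] {p X : ι → ℝ} {l r : ℝ} (hp : ∀ i, 0 ≤ p i)
    (h0 : ∑ i, p i = 1) (h1 : ∑ i, p i * X i = 0) (hl : ∀ i, -l ≤ X i) (hr : ∀ i, X i ≤ r) :
    (∑ i, p i * X i ^ 3) ^ 2 + 4 * (∑ i, p i * X i ^ 2) ^ 3 ≤
      (l + r) ^ 2 * (∑ i, p i * X i ^ 2) ^ 2 := by
  set m2 := ∑ i, p i * X i ^ 2 with hm2
  set m3 := ∑ i, p i * X i ^ 3 with hm3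
  have hm2' : 0 ≤ m2 := Finset.sum_nonneg fun i _ => mul_nonneg (hp i) (sq_nonneg _)
  have hr0 : 0 ≤ r := by
    have h := Finset.sum_nonneg fun i (_ : i ∈ Finset.univ) =>
      mul_nonneg (hp i) (sub_nonneg.2 (hr i))
    simp only [mul_sub, Finset.sum_sub_distrib, ← Finset.sum_mul, h0, h1] at h
    linarith
  have hl0 : 0 ≤ l := by
    have h := Finset.sum_nonneg fun i (_ : i ∈ Finset.univ) =>
      mul_nonneg (hp i) (sub_nonneg.2 (hl i))
    simp only [mul_sub, Finset.sum_sub_distrib, ← Finset.sum_mul, h0, h1] at h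
    linarith
  rcases hm2'.eq_or_lt with h2 | h2
  · have hz := (Finset.sum_eq_zero_iff_of_nonneg
      fun i _ => mul_nonneg (hp i) (sq_nonneg (X i))).1 h2.symm
    have h3 : m3 = 0 := Finset.sum_eq_zero fun i hi => by
      have := hz i hi
      linear_combination X i * this
    rw [← h2, h3]
    simp
  -- the expectation of `(r - X) (r X + m2)²` and of `(l + X) (l X - m2)²`
  have Hr : 0 ≤ r * (r ^ 2 * m2 - r * m3 - m2 ^ 2) := by
    have h := Finset.sum_nonneg fun i (_ : i ∈ Finset.univ) =>
      mul_nonneg (hp i) (mul_nonneg (sub_nonneg.2 (hr i)) (sq_nonneg (r * X i + m2)))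
    have e : ∀ i, p i * ((r - X i) * (r * X i + m2) ^ 2) =
        (r ^ 3 - 2 * r * m2) * (p i * X i ^ 2) + (2 * r ^ 2 * m2 - m2 ^ 2) * (p i * X i)
          + r * m2 ^ 2 * p i - r ^ 2 * (p i * X i ^ 3) := fun i => by ring
    simp only [e, Finset.sum_add_distrib, Finset.sum_sub_distrib, ← Finset.mul_sum, h0, h1,
      ← hm2, ← hm3] at h
    nlinarith
  have Hl : 0 ≤ l * (l ^ 2 * m2 + l * m3 - m2 ^ 2) := by
    have h := Finset.sum_nonneg fun i (_ : i ∈ Finset.univ) =>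
      mul_nonneg (hp i) (mul_nonneg (sub_nonneg.2 (hl i)) (sq_nonneg (l * X i - m2)))
    have e : ∀ i, p i * ((X i - -l) * (l * X i - m2) ^ 2) =
        (l ^ 3 - 2 * l * m2) * (p i * X i ^ 2) + (m2 ^ 2 - 2 * l ^ 2 * m2) * (p i * X i)
          + l * m2 ^ 2 * p i + l ^ 2 * (p i * X i ^ 3) := fun i => by ring
    simp only [e, Finset.sum_add_distrib, ← Finset.mul_sum, h0, h1,
      ← hm2, ← hm3] at h
    nlinarith
  have hlr : m2 ≤ l * r := by
    have h := Finset.sum_nonneg fun i (_ : i ∈ Finset.univ) =>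
      mul_nonneg (hp i) (mul_nonneg (sub_nonneg.2 (hr i)) (sub_nonneg.2 (hl i)))
    have e : ∀ i, p i * ((r - X i) * (X i - -l)) =
        (r - l) * (p i * X i) + l * r * p i - p i * X i ^ 2 := fun i => by ring
    simp only [e, Finset.sum_add_distrib, Finset.sum_sub_distrib, ← Finset.mul_sum, h0, h1,
      ← hm2] at h
    linarith
  have hr1 : 0 < r := hr0.lt_of_ne fun h => by rw [← h] at hlr; linarith
  have hl1 : 0 < l := hl0.lt_of_ne fun h => by rw [← h] at hlr; linarith
  -- the larger root `(m3 / m2 + d / m2) / 2` of `y² - (m3 / m2) y - m2` is at most `r`, and the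
  -- smaller one at least `-l`, so that their distance `d / m2` is at most `l + r`
  have Hr' := nonneg_of_mul_nonneg_right Hr hr1
  have Hl' := nonneg_of_mul_nonneg_right Hl hl1
  have m2sq : 0 < m2 ^ 2 := by positivity
  have hu : 0 < r * m2 - m3 := pos_of_mul_pos_right (a := r) (by nlinarith) hr0
  have hv : 0 < l * m2 + m3 := pos_of_mul_pos_right (a := l) (by nlinarith) hl0
  set d := √(m3 ^ 2 + 4 * m2 ^ 3)
  have hd : d ^ 2 = m3 ^ 2 + 4 * m2 ^ 3 := Real.sq_sqrt (by positivity)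
  have hud : d ≤ 2 * r * m2 - m3 := Real.sqrt_le_iff.2 ⟨by nlinarith, by nlinarith⟩
  have hvd : d ≤ 2 * l * m2 + m3 := Real.sqrt_le_iff.2 ⟨by nlinarith, by nlinarith⟩
  have hsum : d ≤ (l + r) * m2 := by linarith
  calc m3 ^ 2 + 4 * m2 ^ 3 = d ^ 2 := hd.symm
    _ ≤ ((l + r) * m2) ^ 2 := pow_le_pow_left₀ (Real.sqrt_nonneg _) hsum 2
    _ = _ := by ring

/-- The differential inequality `3 κ₃² ≤ A² κ₂² + 2 κ₂ κ₄` between the cumulants of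
`α_1 + … + α_Y`, where `κ₄ = μ₄ - 3 μ₂²` and `A = α_1 + … + α_J`. -/
lemma cumulant_ineq {α : Fin J → ℝ} (hα : ∀ k, 0 < α k) (τ : Fin J → ℝ) (θ : ℝ) :
    3 * centralMoment α τ 3 θ ^ 2 ≤ (∑ s, α s) ^ 2 * centralMoment α τ 2 θ ^ 2 +
      2 * centralMoment α τ 2 θ * (centralMoment α τ 4 θ - 3 * centralMoment α τ 2 θ ^ 2) := by
  have hp := fun j => (prob_pos α τ j θ).le
  have h1 := centralMoment_one α τ θ
  simp only [centralMoment, pow_one] at h1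
  have hA := pearson_ineq hp (sum_prob α τ θ) h1
  have hB := popoviciu_skew (l := meanDisc α τ θ) (r := (∑ s, α s) - meanDisc α τ θ) hp
    (sum_prob α τ θ) h1
    (fun j => by linarith [cumDisc_nonneg hα j]) (fun j => by linarith [cumDisc_le hα j])
  have e : ∀ k, ∑ j : Fin (J + 1), prob α τ j θ * (cumDisc α j - meanDisc α τ θ) ^ k =
      centralMoment α τ k θ := fun _ => rfl
  simp only [e] at hA hB
  rw [add_sub_cancel] at hB
  nlinarith

lemma fisherInfo_nonneg (α τ : Fin J → ℝ) (θ : ℝ) : 0 ≤ fisherInfo α τ θ := by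
  rw [fisherInfo_eq]
  exact Finset.sum_nonneg fun j _ => mul_nonneg (prob_pos α τ j θ).le (sq_nonneg _)

lemma fisherInfo_le {α : Fin J → ℝ} (hα : ∀ k, 0 < α k) (τ : Fin J → ℝ) (θ : ℝ) :
    fisherInfo α τ θ ≤ (∑ s, α s) ^ 2 := by
  rw [fisherInfo_eq_sub]
  have h : ∑ j : Fin (J + 1), prob α τ j θ * cumDisc α j ^ 2 ≤
      ∑ j : Fin (J + 1), prob α τ j θ * (∑ s, α s) ^ 2 :=
    Finset.sum_le_sum fun j _ => mul_le_mul_of_nonneg_left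
      (pow_le_pow_left₀ (cumDisc_nonneg hα j) (cumDisc_le hα j) 2) (prob_pos α τ j θ).le
  rw [← Finset.sum_mul, sum_prob, one_mul] at h
  nlinarith [sq_nonneg (∑ j : Fin (J + 1), prob α τ j θ * cumDisc α j)]

end

section

variable {J : ℕ}

/-! ### Comparison of an item with the limit design -/

/-- The information of the item `τ` at `θ₀ + x` divided by that of the limit design. -/
noncomputable def relInfo (α : Fin J → ℝ) (θ₀ : ℝ) (τ : Fin J → ℝ) (x : ℝ) : ℝ :=
  2 * (1 + Real.cosh ((∑ s, α s) * x)) / (∑ s, α s) ^ 2 * fisherInfo α τ (θ₀ + x)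

lemma relInfo_nonneg (α : Fin J → ℝ) (θ₀ : ℝ) (τ : Fin J → ℝ) (x : ℝ) : 0 ≤ relInfo α θ₀ τ x :=
  mul_nonneg (div_nonneg (by linarith [Real.cosh_pos ((∑ s, α s) * x)]) (sq_nonneg _))
    (fisherInfo_nonneg _ _ _)

lemma continuous_relInfo (α : Fin J → ℝ) (θ₀ : ℝ) (τ : Fin J → ℝ) :
    Continuous (relInfo α θ₀ τ) := by
  have := continuous_fisherInfo α τ
  have := Real.continuous_cosh
  unfold relInfo
  fun_prop

lemma one_add_cosh (x : ℝ) : 1 + Real.cosh x = 2 * Real.cosh (x / 2) ^ 2 := by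
  have h := Real.cosh_two_mul (x / 2)
  rw [mul_div_cancel₀ x two_ne_zero] at h
  rw [h, Real.sinh_sq]
  ring

/-- The relative information is a convex function of `y = tanh (A x / 2)`; as `dy / dx` is a
multiple of `cosh (A x / 2)⁻²`, this is the monotonicity of `cosh (A x / 2) ^ 2 * d/dx`.
Convexity in the odd function `y` makes the symmetrization increase with `|x|`. -/
lemma monotoneOn_relInfo_symm {α : Fin J → ℝ} (hα : ∀ k, 0 < α k) (θ₀ : ℝ) (τ : Fin J → ℝ) :
    MonotoneOn (fun x => relInfo α θ₀ τ x + relInfo α θ₀ τ (-x)) (Set.Ici 0) := by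
  set A := ∑ s, α s with hA
  set k := A / 2 with hk
  let M (n : ℕ) (x : ℝ) := centralMoment α τ n (θ₀ + x)
  let r (x : ℝ) := Real.cosh (k * x) ^ 2 * M 2 x
  let r' (x : ℝ) := 2 * k * Real.cosh (k * x) * Real.sinh (k * x) * M 2 x +
    Real.cosh (k * x) ^ 2 * M 3 x
  have hrel : ∀ x, relInfo α θ₀ τ x = 4 / A ^ 2 * r x := fun x => by
    simp only [relInfo, fisherInfo_eq, one_add_cosh, r, M, ← hA, hk]
    rw [show A * x / 2 = A / 2 * x by ring]
    ring
  have hM : ∀ n x, HasDerivAt (M (n + 1)) (M (n + 2) x - (n + 1) * M 2 x * M n x) x :=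
    fun n x => HasDerivAt.comp_const_add θ₀ x (hasDerivAt_centralMoment α τ n (θ₀ + x))
  have hM2 : ∀ x, HasDerivAt (M 2) (M 3 x) x := fun x => by
    refine (hM 1 x).congr_deriv ?_
    simp [M, centralMoment_one]
  have hM3 : ∀ x, HasDerivAt (M 3) (M 4 x - 3 * M 2 x ^ 2) x := fun x => by
    refine (hM 2 x).congr_deriv ?_
    push_cast
    ring
  have hkx : ∀ x, HasDerivAt (fun x => k * x) k x := fun x => by
    simpa using (hasDerivAt_id x).const_mul k
  have hc : ∀ x, HasDerivAt (fun x => Real.cosh (k * x)) (Real.sinh (k * x) * k) x :=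
    fun x => (hkx x).cosh
  have hs : ∀ x, HasDerivAt (fun x => Real.sinh (k * x)) (Real.cosh (k * x) * k) x :=
    fun x => (hkx x).sinh
  have hr : ∀ x, HasDerivAt r (r' x) x := fun x => by
    refine (((hc x).fun_pow 2).mul (hM2 x)).congr_deriv ?_
    simp only [r']
    ring
  have hF : ∀ x, HasDerivAt (fun x => Real.cosh (k * x) ^ 2 * r' x)
      (Real.cosh (k * x) ^ 2 * (6 * k ^ 2 * Real.sinh (k * x) ^ 2 * M 2 x +
        2 * k ^ 2 * Real.cosh (k * x) ^ 2 * M 2 x +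
        6 * k * Real.sinh (k * x) * Real.cosh (k * x) * M 3 x +
        Real.cosh (k * x) ^ 2 * (M 4 x - 3 * M 2 x ^ 2))) x := fun x => by
    refine (((hc x).fun_pow 2).mul (((((hc x).const_mul (2 * k)).mul (hs x)).mul (hM2 x)).add
      (((hc x).fun_pow 2).mul (hM3 x)))).congr_deriv ?_
    simp only [Pi.mul_apply, Pi.add_apply]
    ring
  have hFmono : Monotone (fun x => Real.cosh (k * x) ^ 2 * r' x) := by
    refine monotone_of_hasDerivAt_nonneg hF fun x => mul_nonneg (sq_nonneg _) ?_
    have hcum : 3 * M 3 x ^ 2 ≤ A ^ 2 * M 2 x ^ 2 + 2 * M 2 x * (M 4 x - 3 * M 2 x ^ 2) :=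
      cumulant_ineq hα τ (θ₀ + x)
    have hM2n : 0 ≤ M 2 x := by
      have := fisherInfo_nonneg α τ (θ₀ + x)
      rwa [fisherInfo_eq] at this
    have hM4n : 0 ≤ M 4 x := Finset.sum_nonneg fun j _ =>
      mul_nonneg (prob_pos α τ j _).le (by positivity)
    rcases hM2n.eq_or_lt with h | h
    · have h3 : M 3 x = 0 := by
        rw [← h] at hcum
        nlinarith [sq_nonneg (M 3 x)]
      rw [h3, ← h]
      have : 0 ≤ Real.cosh (k * x) ^ 2 * M 4 x := by positivity
      linarith
    · -- complete the square in `sinh`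
      refine nonneg_of_mul_nonneg_right (a := 2 * M 2 x) ?_ (by positivity)
      have h1 := mul_nonneg (sq_nonneg (Real.cosh (k * x))) (sub_nonneg.2 hcum)
      rw [show A = 2 * k by rw [hk]; ring] at h1
      nlinarith [sq_nonneg (2 * k * Real.sinh (k * x) * M 2 x + Real.cosh (k * x) * M 3 x)]
  have hmono : MonotoneOn (fun x => r x + r (-x)) (Set.Ici 0) := by
    have hd : ∀ x, HasDerivAt (fun x => r x + r (-x)) (r' x - r' (-x)) x := fun x => by
      refine ((hr x).add ((hr (-x)).scomp x (hasDerivAt_neg x))).congr_deriv ?_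
      simp [sub_eq_add_neg]
    refine monotoneOn_of_deriv_nonneg (convex_Ici 0)
      (fun x _ => (hd x).continuousAt.continuousWithinAt)
      (fun x _ => (hd x).differentiableAt.differentiableWithinAt) fun x hx => ?_
    rw [interior_Ici, Set.mem_Ioi] at hx
    rw [(hd x).deriv]
    have h := hFmono (show -x ≤ x by linarith)
    simp only [mul_neg, Real.cosh_neg] at h
    have hpos : 0 < Real.cosh (k * x) ^ 2 := pow_pos (Real.cosh_pos _) 2
    exact sub_nonneg.2 (le_of_mul_le_mul_left h hpos)
  intro x hx y hy hxy
  have h := mul_le_mul_of_nonneg_left (hmono hx hy hxy) (show 0 ≤ 4 / A ^ 2 by positivity)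
  simp only [hrel]
  linarith

/-! ### The limit design -/

/-- The product `π_J π_0` at the limit design and the argument `θ₀ + x`. -/
noncomputable def starVar (α : Fin J → ℝ) (x : ℝ) : ℝ :=
  (2 * (1 + Real.cosh ((∑ s, α s) * x)))⁻¹

lemma exp_div_sq (y : ℝ) :
    Real.exp y / (1 + Real.exp y) ^ 2 = (2 * (1 + Real.cosh y))⁻¹ := by
  rw [Real.cosh_eq, Real.exp_neg]
  have := Real.exp_pos y
  field_simp
  ring

lemma starVar_pos (α : Fin J → ℝ) (x : ℝ) : 0 < starVar α x := by
  have := Real.cosh_pos ((∑ s, α s) * x)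
  unfold starVar
  positivity

lemma starVar_le (α : Fin J → ℝ) (x : ℝ) : starVar α x ≤ 1 / 4 := by
  have := Real.one_le_cosh ((∑ s, α s) * x)
  rw [starVar, one_div]
  exact inv_anti₀ (by norm_num) (by linarith)

lemma continuous_starVar (α : Fin J → ℝ) : Continuous (starVar α) := by
  have := Real.continuous_cosh
  refine Continuous.inv₀ (by fun_prop) fun x => ?_
  have := Real.cosh_pos ((∑ s, α s) * x)
  positivity

variable [NeZero J]

lemma linPred_tauSeq (α : Fin J → ℝ) (θ₀ c θ : ℝ) (j : Fin (J + 1)) :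
    linPred α (tauSeq α θ₀ c) θ j = cumDisc α j * (θ - θ₀) +
      if j ≠ 0 ∧ j ≠ Fin.last J then -(α 0 * α (Fin.rev 0) * c) else 0 := by
  have h : ∀ s, α s * (θ - tauSeq α θ₀ c s) = α s * (θ - θ₀) -
      (if s = 0 then α 0 * α (Fin.rev 0) * c else 0) +
      (if s = Fin.rev 0 then α 0 * α (Fin.rev 0) * c else 0) := fun s => by
    unfold tauSeq
    by_cases h1 : s = 0 <;> by_cases h2 : s = Fin.rev 0
    · -- only for `J = 1` do the first and the last step coincide
      have h3 : (Fin.rev 0 : Fin J) = 0 := h2.symm.trans h1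
      rw [if_pos h1, if_pos h2, if_pos h1, if_pos h2, h3, h1]
      ring
    · rw [if_pos h1, if_neg h2, if_pos h1, if_neg h2, h1]
      ring
    · simp only [if_neg h1, if_pos h2]
      rw [← h2]
      ring
    · simp only [if_neg h1, if_neg h2]
      ring
  unfold linPred cumDisc
  simp only [h, Finset.sum_add_distrib, Finset.sum_sub_distrib, ← Finset.sum_mul,
    Finset.sum_ite_eq', Finset.mem_filter, Finset.mem_univ, true_and]
  have h0 : (((0 : Fin J) : ℕ) < j) ↔ j ≠ 0 := by
    rw [Fin.ne_iff_vne]; simp [Nat.pos_iff_ne_zero]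
  have hl : (((Fin.rev 0 : Fin J) : ℕ) < j) ↔ j = Fin.last J := by
    rw [Fin.ext_iff]; simp [Fin.val_rev]; have := NeZero.pos J; omega
  have hne : Fin.last J ≠ 0 := by
    rw [Fin.ne_iff_vne]; simp [NeZero.ne J]
  simp only [h0, hl]
  by_cases hj : j = Fin.last J
  · simp [hj, hne]
  · by_cases hj0 : j = 0 <;> simp [hj, hj0, hne.symm]; ring

lemma sum_pos_of_pos {α : Fin J → ℝ} (hα : ∀ k, 0 < α k) : 0 < ∑ s, α s :=
  Finset.sum_pos (fun s _ => hα s) Finset.univ_nonempty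

/-- In the limit only the two extreme categories survive. -/
lemma tendsto_prob_tauSeq {α : Fin J → ℝ} (hα : ∀ k, 0 < α k) (θ₀ θ : ℝ) (j : Fin (J + 1)) :
    Tendsto (fun c => prob α (tauSeq α θ₀ c) j θ) atTop
      (𝓝 (((if j = 0 then 1 else 0) +
        if j = Fin.last J then Real.exp ((∑ s, α s) * (θ - θ₀)) else 0) /
        (1 + Real.exp ((∑ s, α s) * (θ - θ₀))))) := by
  have hne : Fin.last J ≠ 0 := by
    rw [Fin.ne_iff_vne]; simp [NeZero.ne J]
  have h : ∀ j : Fin (J + 1), Tendsto (fun c => Real.exp (linPred α (tauSeq α θ₀ c) θ j)) atTop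
      (𝓝 ((if j = 0 then 1 else 0) +
        if j = Fin.last J then Real.exp ((∑ s, α s) * (θ - θ₀)) else 0)) := fun j => by
    simp only [linPred_tauSeq]
    by_cases hj : j = Fin.last J
    · simp [hj, hne, cumDisc_last]
    · by_cases hj0 : j = 0
      · simp [hj0, hne.symm, cumDisc_zero]
      · simp only [hj, hj0, ne_eq, not_false_eq_true, and_self, if_true, if_false, add_zero]
        refine Real.tendsto_exp_atBot.comp (tendsto_atBot_add_const_left _ _ ?_)
        exact tendsto_neg_atTop_atBot.comp
          (tendsto_id.const_mul_atTop (mul_pos (hα 0) (hα _)))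
  have hsum := tendsto_finsetSum Finset.univ fun (k : Fin (J + 1)) _ => h k
  have e : ∑ k : Fin (J + 1), (((if k = 0 then 1 else 0) : ℝ) +
      if k = Fin.last J then Real.exp ((∑ s, α s) * (θ - θ₀)) else 0) =
      1 + Real.exp ((∑ s, α s) * (θ - θ₀)) := by
    rw [Finset.sum_add_distrib, Finset.sum_ite_eq', Finset.sum_ite_eq']
    simp
  rw [e] at hsum
  exact (h j).div hsum (by positivity)

lemma probStar_mul {α : Fin J → ℝ} (hα : ∀ k, 0 < α k) (θ₀ θ : ℝ) :
    probStar α θ₀ (Fin.last J) θ * probStar α θ₀ 0 θ = starVar α (θ - θ₀) := by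
  have hne : Fin.last J ≠ 0 := by
    rw [Fin.ne_iff_vne]; simp [NeZero.ne J]
  unfold probStar
  rw [(tendsto_prob_tauSeq hα θ₀ θ _).limUnder_eq, (tendsto_prob_tauSeq hα θ₀ θ _).limUnder_eq,
    starVar, ← exp_div_sq]
  simp only [hne, hne.symm, if_true, if_false]
  rw [zero_add, add_zero, div_mul_div_comm, mul_one, sq]

lemma tendsto_fisherInfo_tauSeq {α : Fin J → ℝ} (hα : ∀ k, 0 < α k) (θ₀ θ : ℝ) :
    Tendsto (fun c => fisherInfo α (tauSeq α θ₀ c) θ) atTop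
      (𝓝 ((∑ s, α s) ^ 2 * starVar α (θ - θ₀))) := by
  have h := fun j => tendsto_prob_tauSeq hα θ₀ θ j
  have h2 := (tendsto_finsetSum Finset.univ fun (j : Fin (J + 1)) _ =>
    (h j).mul_const (cumDisc α j ^ 2)).sub ((tendsto_finsetSum Finset.univ
      fun (j : Fin (J + 1)) _ => (h j).mul_const (cumDisc α j)).pow 2)
  simp only [← fisherInfo_eq_sub] at h2
  convert h2 using 2
  rw [starVar, ← exp_div_sq]
  simp only [add_div, add_mul, ite_div, ite_mul, zero_div, zero_mul, Finset.sum_add_distrib,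
    Finset.sum_ite_eq', Finset.mem_univ, if_true, Fin.val_zero, Fin.val_last, cumDisc_zero,
    cumDisc_last]
  field_simp
  ring

lemma fisherInfoStar_eq {α : Fin J → ℝ} (hα : ∀ k, 0 < α k) (θ₀ θ : ℝ) :
    fisherInfoStar α θ₀ θ = (∑ s, α s) ^ 2 * starVar α (θ - θ₀) :=
  (tendsto_fisherInfo_tauSeq hα θ₀ θ).limUnder_eq

lemma fisherInfo_eq_relInfo {α : Fin J → ℝ} (hα : ∀ k, 0 < α k) (θ₀ x : ℝ) (τ : Fin J → ℝ) :
    fisherInfo α τ (θ₀ + x) = relInfo α θ₀ τ x * fisherInfoStar α θ₀ (θ₀ + x) := by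
  have h1 := Real.cosh_pos ((∑ s, α s) * x)
  have h2 := (sum_pos_of_pos hα).ne'
  rw [fisherInfoStar_eq hα, add_sub_cancel_left, relInfo, starVar]
  field_simp

end

section

variable {J : ℕ}

/-! ### Thresholds of scale conditions -/

lemma exists_isThreshold {C : ℝ → Prop} (anti : ∀ s s', 0 < s' → s' ≤ s → C s → C s')
    (closed : ∀ s, 0 < s → (∀ s', 0 < s' → s' < s → C s') → C s) : ∃ x, IsThreshold C x := by
  refine ⟨⨆ s : {s : ℝ // 0 < s ∧ C s}, ENNReal.ofReal s, fun s hs =>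
    ⟨fun h => le_iSup (fun s : {s : ℝ // 0 < s ∧ C s} => ENNReal.ofReal s) ⟨s, hs, h⟩,
      fun h => closed s hs fun s' hs' hlt => ?_⟩⟩
  obtain ⟨u, hu⟩ := lt_iSup_iff.1 (((ENNReal.ofReal_lt_ofReal_iff hs).2 hlt).trans_le h)
  exact anti u s' hs' ((ENNReal.ofReal_lt_ofReal_iff u.2.1).1 hu).le u.2.2

lemma IsThreshold.le_of_imp {C D : ℝ → Prop} {x y : ℝ≥0∞} (hC : IsThreshold C x)
    (hD : IsThreshold D y) (h : ∀ s, 0 < s → C s → D s) : x ≤ y := by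
  by_contra! hlt
  obtain ⟨r, hr, h1, h2⟩ := ENNReal.lt_iff_exists_real_btwn.1 hlt
  have hr0 : 0 < r := ENNReal.ofReal_pos.1 (h1.trans_le' bot_le)
  exact absurd ((hD r hr0).1 (h r hr0 ((hC r hr0).2 h2.le))) h1.not_ge

lemma IsThreshold.unique {C : ℝ → Prop} {x y : ℝ≥0∞} (hx : IsThreshold C x)
    (hy : IsThreshold C y) : y = x :=
  le_antisymm (hy.le_of_imp hx fun _ _ h => h) (hx.le_of_imp hy fun _ _ h => h)

lemma IsThreshold.pos {C : ℝ → Prop} {x : ℝ≥0∞} (hx : IsThreshold C x) {s : ℝ} (hs : 0 < s)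
    (h : C s) : 0 < x :=
  (ENNReal.ofReal_pos.2 hs).trans_le ((hx s hs).1 h)

lemma IsThreshold.lt_top {C : ℝ → Prop} {x : ℝ≥0∞} (hx : IsThreshold C x) {s : ℝ} (hs : 0 < s)
    (h : ¬ C s) : x < ∞ := by
  refine lt_of_not_ge fun hle => h ((hx s hs).2 (le_trans le_top hle))

/-- Fatou's lemma for a convergent sequence of functions with uniformly bounded integrals. -/
lemma lintegral_le_of_tendsto {X : Type*} [MeasurableSpace X] {μ : Measure X}
    {F : ℕ → X → ℝ≥0∞} {G : X → ℝ≥0∞} {K : ℝ≥0∞} (hF : ∀ n, Measurable (F n))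
    (hlim : ∀ x, Tendsto (fun n => F n x) atTop (𝓝 (G x))) (hK : ∀ n, ∫⁻ x, F n x ∂μ ≤ K) :
    ∫⁻ x, G x ∂μ ≤ K := by
  calc ∫⁻ x, G x ∂μ = ∫⁻ x, liminf (fun n => F n x) atTop ∂μ :=
        lintegral_congr fun x => (hlim x).liminf_eq.symm
    _ ≤ liminf (fun n => ∫⁻ x, F n x ∂μ) atTop := lintegral_liminf_le hF
    _ ≤ liminf (fun _ : ℕ => K) atTop := liminf_le_liminf (Eventually.of_forall hK)
    _ = K := liminf_const K

lemma lintegral_comp_neg {P : Measure ℝ} (hP : P.map (fun z => -z) = P) {F : ℝ → ℝ≥0∞}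
    (hF : Measurable F) : ∫⁻ z, F (-z) ∂P = ∫⁻ z, F z ∂P := by
  conv_rhs => rw [← hP]
  rw [lintegral_map hF measurable_neg]

/-- Under a symmetric distribution only the symmetrization of `F` matters. -/
lemma two_mul_lintegral {P : Measure ℝ} (hP : P.map (fun z => -z) = P) {F : ℝ → ℝ}
    (hF : Continuous F) (h0 : ∀ x, 0 ≤ F x) (s : ℝ) :
    2 * ∫⁻ z, ENNReal.ofReal (F (s * z)) ∂P =
      ∫⁻ z, ENNReal.ofReal (F (s * z) + F (-(s * z))) ∂P := by
  have hm : Measurable fun z => ENNReal.ofReal (F (s * z)) :=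
    ENNReal.measurable_ofReal.comp (hF.comp (continuous_const_mul s)).measurable
  simp only [ENNReal.ofReal_add (h0 _) (h0 _)]
  rw [lintegral_add_left hm, two_mul]
  congr 1
  rw [← lintegral_comp_neg hP hm]
  simp only [mul_neg]

lemma lintegral_scale_mono {P : Measure ℝ} (hP : P.map (fun z => -z) = P) {F : ℝ → ℝ}
    (hF : Continuous F) (h0 : ∀ x, 0 ≤ F x)
    (hmono : MonotoneOn (fun x => F x + F (-x)) (Set.Ici 0)) {s s' : ℝ} (hs' : 0 < s')
    (h : s' ≤ s) :
    ∫⁻ z, ENNReal.ofReal (F (s' * z)) ∂P ≤ ∫⁻ z, ENNReal.ofReal (F (s * z)) ∂P := by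
  have key : 2 * ∫⁻ z, ENNReal.ofReal (F (s' * z)) ∂P ≤
      2 * ∫⁻ z, ENNReal.ofReal (F (s * z)) ∂P := by
    rw [two_mul_lintegral hP hF h0, two_mul_lintegral hP hF h0]
    have habs : ∀ x, F x + F (-x) = F |x| + F (-|x|) := fun x => by
      rcases abs_choice x with h | h <;> rw [h]
      rw [neg_neg, add_comm]
    refine lintegral_mono fun z => ENNReal.ofReal_le_ofReal ?_
    rw [habs (s' * z), habs (s * z)]
    refine hmono (Set.mem_Ici.2 (abs_nonneg _)) (Set.mem_Ici.2 (abs_nonneg _)) ?_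
    rw [abs_mul, abs_mul, abs_of_pos hs', abs_of_pos (hs'.trans_le h)]
    exact mul_le_mul_of_nonneg_right h (abs_nonneg z)
  exact (ENNReal.mul_le_mul_iff_right two_ne_zero ENNReal.ofNat_ne_top).1 key

/-- A bound on `∫ F (s z) dP` that holds below the scale `s` holds at `s`. -/
lemma lintegral_scale_closed {P : Measure ℝ} {F : ℝ → ℝ} (hF : Continuous F) {K : ℝ≥0∞} {s : ℝ}
    (hs : 0 < s) (h : ∀ s', 0 < s' → s' < s → ∫⁻ z, ENNReal.ofReal (F (s' * z)) ∂P ≤ K) :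
    ∫⁻ z, ENNReal.ofReal (F (s * z)) ∂P ≤ K := by
  obtain ⟨u, -, hu, hlim⟩ := exists_seq_strictMono_tendsto' hs
  refine lintegral_le_of_tendsto (F := fun n z => ENNReal.ofReal (F (u n * z)))
    (fun n => ?_) (fun z => ?_) fun n => h (u n) (hu n).1 (hu n).2
  · exact ENNReal.measurable_ofReal.comp (hF.comp (continuous_const_mul _)).measurable
  · exact ((ENNReal.continuous_ofReal.comp hF).tendsto _).comp (hlim.mul_const z)

lemma exists_isThreshold_lintegral {P : Measure ℝ} (hP : P.map (fun z => -z) = P) {F : ℝ → ℝ}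
    (hF : Continuous F) (h0 : ∀ x, 0 ≤ F x)
    (hmono : MonotoneOn (fun x => F x + F (-x)) (Set.Ici 0)) (K : ℝ≥0∞) :
    ∃ x, IsThreshold (fun s => ∫⁻ z, ENNReal.ofReal (F (s * z)) ∂P ≤ K) x :=
  exists_isThreshold (fun _ _ hs' h hC => (lintegral_scale_mono hP hF h0 hmono hs' h).trans hC)
    fun _ hs h => lintegral_scale_closed hF hs h

lemma integrable_and_integral_le_iff {X : Type*} [MeasurableSpace X] {μ : Measure X} {f : X → ℝ}
    (hf : AEStronglyMeasurable f μ) (h0 : ∀ x, 0 ≤ f x) {K : ℝ} (hK : 0 ≤ K) :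
    (Integrable f μ ∧ ∫ x, f x ∂μ ≤ K) ↔ ∫⁻ x, ENNReal.ofReal (f x) ∂μ ≤ ENNReal.ofReal K := by
  have hae : 0 ≤ᵐ[μ] f := Eventually.of_forall h0
  constructor
  · rintro ⟨hi, h⟩
    rw [← ofReal_integral_eq_lintegral_ofReal hi hae]
    exact ENNReal.ofReal_le_ofReal h
  · intro h
    have hi : Integrable f μ :=
      ⟨hf, (hasFiniteIntegral_iff_ofReal hae).2 (h.trans_lt ENNReal.ofReal_lt_top)⟩
    rw [← ofReal_integral_eq_lintegral_ofReal hi hae, ENNReal.ofReal_le_ofReal_iff hK] at h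
    exact ⟨hi, h⟩

lemma measurable_affine (θ₀ s : ℝ) : Measurable fun z : ℝ => θ₀ + s * z := by fun_prop

lemma isProbabilityMeasure_scaleFamily (P : Measure ℝ) [IsProbabilityMeasure P] (θ₀ s : ℝ) :
    IsProbabilityMeasure (scaleFamily P θ₀ s) :=
  Measure.isProbabilityMeasure_map (measurable_affine θ₀ s).aemeasurable

lemma lintegral_scaleFamily (P : Measure ℝ) (θ₀ s : ℝ) {F : ℝ → ℝ≥0∞} (hF : Measurable F) :
    ∫⁻ θ, F (θ - θ₀) ∂(scaleFamily P θ₀ s) = ∫⁻ z, F (s * z) ∂P := by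
  have hm : Measurable fun θ => F (θ - θ₀) := hF.comp (measurable_id.sub_const θ₀)
  rw [scaleFamily, lintegral_map hm (measurable_affine θ₀ s)]
  simp

lemma integral_scaleFamily (P : Measure ℝ) (θ₀ s : ℝ) {F : ℝ → ℝ} (hF : Continuous F) :
    ∫ θ, F (θ - θ₀) ∂(scaleFamily P θ₀ s) = ∫ z, F (s * z) ∂P := by
  have hc : Continuous fun θ => F (θ - θ₀) := hF.comp (continuous_sub_right θ₀)
  rw [scaleFamily, integral_map (measurable_affine θ₀ s).aemeasurable
    hc.aestronglyMeasurable]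
  simp

lemma integrable_scaleFamily (P : Measure ℝ) (θ₀ s : ℝ) {F : ℝ → ℝ} (hF : Continuous F) :
    Integrable (fun θ => F (θ - θ₀)) (scaleFamily P θ₀ s) ↔ Integrable (fun z => F (s * z)) P := by
  have hc : Continuous fun θ => F (θ - θ₀) := hF.comp (continuous_sub_right θ₀)
  rw [scaleFamily, integrable_map_measure
    hc.aestronglyMeasurable (measurable_affine θ₀ s).aemeasurable]
  simp [Function.comp_def]

/-! ### The necessary conditions -/

lemma starVar_neg (α : Fin J → ℝ) (x : ℝ) : starVar α (-x) = starVar α x := by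
  simp [starVar]

lemma starVar_zero (α : Fin J → ℝ) : starVar α 0 = 1 / 4 := by
  norm_num [starVar]

lemma antitoneOn_starVar (α : Fin J → ℝ) : AntitoneOn (starVar α) (Set.Ici 0) := by
  intro x hx y hy hxy
  have h : Real.cosh ((∑ s, α s) * x) ≤ Real.cosh ((∑ s, α s) * y) := by
    rw [Real.cosh_le_cosh, abs_mul, abs_mul, abs_of_nonneg (Set.mem_Ici.1 hx),
      abs_of_nonneg (Set.mem_Ici.1 hy)]
    exact mul_le_mul_of_nonneg_left hxy (abs_nonneg _)
  have := Real.cosh_pos ((∑ s, α s) * x)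
  exact inv_anti₀ (by positivity) (by linarith)

lemma continuous_inv_starVar (α : Fin J → ℝ) : Continuous fun x => (starVar α x)⁻¹ :=
  (continuous_starVar α).inv₀ fun x => (starVar_pos α x).ne'

lemma integrable_starVar (α : Fin J → ℝ) (P : Measure ℝ) [IsProbabilityMeasure P] (s : ℝ) :
    Integrable (fun z => starVar α (s * z)) P :=
  Integrable.of_bound
    ((continuous_starVar α).comp (continuous_const_mul s)).aestronglyMeasurable (1 / 4)
    (Eventually.of_forall fun z => by
      rw [Real.norm_of_nonneg (starVar_pos α _).le]
      exact starVar_le α _)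

lemma integral_starVar_ge_iff (α : Fin J → ℝ) (P : Measure ℝ)
    [IsProbabilityMeasure P] (s : ℝ) :
    1 / 6 ≤ ∫ z, starVar α (s * z) ∂P ↔
      ∫⁻ z, ENNReal.ofReal (1 / 4 - starVar α (s * z)) ∂P ≤ ENNReal.ofReal (1 / 12) := by
  have hi := integrable_starVar α P s
  have hd : Integrable (fun z => 1 / 4 - starVar α (s * z)) P := (integrable_const _).sub hi
  rw [← integrable_and_integral_le_iff hd.aestronglyMeasurable
    (fun z => sub_nonneg.2 (starVar_le α _)) (by norm_num), integral_sub (integrable_const _) hi]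
  simp only [hd, true_and, integral_const, probReal_univ, one_smul]
  constructor <;> intro h <;> linarith

variable [NeZero J]

lemma necessaryCondM1_iff {α : Fin J → ℝ} (hα : ∀ k, 0 < α k) (θ₀ : ℝ) (P : Measure ℝ) (s : ℝ) :
    NecessaryCondM1 α θ₀ (scaleFamily P θ₀ s) ↔
      ∫⁻ z, ENNReal.ofReal (starVar α (s * z))⁻¹ ∂P ≤ ENNReal.ofReal 6 := by
  have hc := continuous_inv_starVar α
  simp only [NecessaryCondM1, probStar_mul hα]
  rw [integrable_scaleFamily P θ₀ s hc, integral_scaleFamily P θ₀ s hc]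
  exact integrable_and_integral_le_iff
    (hc.comp (continuous_const_mul s)).aestronglyMeasurable
    (fun z => (inv_pos.2 (starVar_pos α _)).le) (by norm_num)

lemma necessaryCond0_iff {α : Fin J → ℝ} (hα : ∀ k, 0 < α k) (θ₀ : ℝ) (P : Measure ℝ) (s : ℝ) :
    NecessaryCond0 α θ₀ (scaleFamily P θ₀ s) ↔ 1 / 6 ≤ ∫ z, starVar α (s * z) ∂P := by
  simp only [NecessaryCond0, probStar_mul hα]
  rw [integral_scaleFamily P θ₀ s (continuous_starVar α)]

lemma exists_isThreshold_necessaryCondM1 {α : Fin J → ℝ} (hα : ∀ k, 0 < α k) (θ₀ : ℝ)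
    {P : Measure ℝ} (hP : P.map (fun z => -z) = P) :
    ∃ x, IsThreshold (fun s => NecessaryCondM1 α θ₀ (scaleFamily P θ₀ s)) x := by
  simp only [necessaryCondM1_iff hα]
  refine exists_isThreshold_lintegral hP (continuous_inv_starVar α)
    (fun x => (inv_pos.2 (starVar_pos α x)).le) (fun x hx y hy hxy => ?_) _
  simp only [starVar_neg]
  have := inv_anti₀ (starVar_pos α y) (antitoneOn_starVar α hx hy hxy)
  linarith

lemma exists_isThreshold_necessaryCond0 {α : Fin J → ℝ} (hα : ∀ k, 0 < α k) (θ₀ : ℝ)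
    {P : Measure ℝ} [IsProbabilityMeasure P] (hP : P.map (fun z => -z) = P) :
    ∃ x, IsThreshold (fun s => NecessaryCond0 α θ₀ (scaleFamily P θ₀ s)) x := by
  simp only [necessaryCond0_iff hα, integral_starVar_ge_iff]
  refine exists_isThreshold_lintegral (F := fun x => 1 / 4 - starVar α x) hP
    (continuous_const.sub (continuous_starVar α))
    (fun x => sub_nonneg.2 (starVar_le α x)) (fun x hx y hy hxy => ?_) _
  simp only [starVar_neg]
  have := antitoneOn_starVar α hx hy hxy
  linarith

lemma NecessaryCondM1.necessaryCond0 {α : Fin J → ℝ} (hα : ∀ k, 0 < α k) {θ₀ : ℝ} {P : Measure ℝ}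
    [IsProbabilityMeasure P] {s : ℝ} (h : NecessaryCondM1 α θ₀ (scaleFamily P θ₀ s)) :
    NecessaryCond0 α θ₀ (scaleFamily P θ₀ s) := by
  have hc := continuous_inv_starVar α
  rw [necessaryCond0_iff hα]
  simp only [NecessaryCondM1, probStar_mul hα] at h
  rw [integrable_scaleFamily P θ₀ s hc, integral_scaleFamily P θ₀ s hc] at h
  -- the tangent of `v ↦ 1 / v` at `v = 1 / 6`
  have htan : ∀ z, 1 / 3 - (1 / 36) * (starVar α (s * z))⁻¹ ≤ starVar α (s * z) := fun z => by
    have hv := starVar_pos α (s * z)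
    have e : starVar α (s * z) - (1 / 3 - (1 / 36) * (starVar α (s * z))⁻¹) =
        (starVar α (s * z) - 1 / 6) ^ 2 / starVar α (s * z) := by
      field_simp
      ring
    have : 0 ≤ (starVar α (s * z) - 1 / 6) ^ 2 / starVar α (s * z) := by positivity
    linarith
  have hm := integral_mono ((integrable_const (1 / 3 : ℝ)).sub (h.1.const_mul (1 / 36)))
    (integrable_starVar α P s) htan
  simp only [Pi.sub_apply] at hm
  rw [integral_sub (integrable_const _) (h.1.const_mul _), integral_const_mul] at hm
  simp only [integral_const, probReal_univ, one_smul] at hm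
  linarith [h.2]

lemma exists_necessaryCond0 {α : Fin J → ℝ} (hα : ∀ k, 0 < α k) (θ₀ : ℝ) (P : Measure ℝ)
    [IsProbabilityMeasure P] : ∃ s, 0 < s ∧ NecessaryCond0 α θ₀ (scaleFamily P θ₀ s) := by
  simp only [necessaryCond0_iff hα]
  have hlim : Tendsto (fun n : ℕ => ∫ z, starVar α (1 / ((n : ℝ) + 1) * z) ∂P) atTop
      (𝓝 (∫ _, 1 / 4 ∂P)) := by
    refine tendsto_integral_of_dominated_convergence (fun _ => 1 / 4)
      (fun n => (integrable_starVar α P _).aestronglyMeasurable) (integrable_const _)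
      (fun n => Eventually.of_forall fun z => ?_) (Eventually.of_forall fun z => ?_)
    · rw [Real.norm_of_nonneg (starVar_pos α _).le]
      exact starVar_le α _
    · rw [← starVar_zero α]
      refine ((continuous_starVar α).tendsto 0).comp ?_
      simpa using (tendsto_one_div_add_atTop_nhds_zero_nat (𝕜 := ℝ)).mul_const z
  simp only [integral_const, probReal_univ, one_smul] at hlim
  obtain ⟨n, hn⟩ := (hlim.eventually (lt_mem_nhds (show (1 / 6 : ℝ) < 1 / 4 by norm_num))).exists
  exact ⟨_, Nat.one_div_pos_of_nat, hn.le⟩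

lemma exists_necessaryCondM1 {α : Fin J → ℝ} (hα : ∀ k, 0 < α k) (θ₀ : ℝ) (P : Measure ℝ)
    [IsProbabilityMeasure P] {s : ℝ} (hs : 0 < s)
    (hi : Integrable (fun z => (starVar α (s * z))⁻¹) P) :
    ∃ s, 0 < s ∧ NecessaryCondM1 α θ₀ (scaleFamily P θ₀ s) := by
  have hc := continuous_inv_starVar α
  have hdom : ∀ (n : ℕ) z, ‖(starVar α (s * (1 / ((n : ℝ) + 1)) * z))⁻¹‖ ≤
      (starVar α (s * z))⁻¹ := fun n z => by
    rw [Real.norm_of_nonneg (inv_pos.2 (starVar_pos α _)).le]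
    refine inv_anti₀ (starVar_pos α _) ?_
    have habs : ∀ x, starVar α x = starVar α |x| := fun x => by
      rcases abs_choice x with h | h <;> rw [h]
      rw [starVar_neg]
    rw [habs (s * z), habs (s * (1 / ((n : ℝ) + 1)) * z)]
    refine antitoneOn_starVar α (Set.mem_Ici.2 (abs_nonneg _)) (Set.mem_Ici.2 (abs_nonneg _)) ?_
    have h1 : (0 : ℝ) < 1 / ((n : ℝ) + 1) := Nat.one_div_pos_of_nat
    have h2 : 1 / ((n : ℝ) + 1) ≤ 1 := by
      rw [div_le_one (by positivity)]
      linarith [Nat.cast_nonneg (α := ℝ) n]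
    rw [abs_mul, abs_mul, abs_mul, abs_of_pos h1]
    exact mul_le_mul_of_nonneg_right (mul_le_of_le_one_right (abs_nonneg s) h2) (abs_nonneg z)
  have hlim : Tendsto (fun n : ℕ => ∫ z, (starVar α (s * (1 / ((n : ℝ) + 1)) * z))⁻¹ ∂P) atTop
      (𝓝 (∫ _, 4 ∂P)) := by
    refine tendsto_integral_of_dominated_convergence _
      (fun n => (hc.comp (continuous_const_mul _)).aestronglyMeasurable) hi
      (fun n => Eventually.of_forall (hdom n)) (Eventually.of_forall fun z => ?_)
    have h4 : (4 : ℝ) = (starVar α 0)⁻¹ := by rw [starVar_zero]; norm_num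
    rw [h4]
    refine (hc.tendsto 0).comp ?_
    simpa using ((tendsto_one_div_add_atTop_nhds_zero_nat (𝕜 := ℝ)).const_mul s).mul_const z
  simp only [integral_const, probReal_univ, one_smul] at hlim
  obtain ⟨n, hn⟩ := (hlim.eventually (gt_mem_nhds (show (4 : ℝ) < 6 by norm_num))).exists
  refine ⟨s * (1 / ((n : ℝ) + 1)), mul_pos hs Nat.one_div_pos_of_nat, ?_⟩
  refine (necessaryCondM1_iff hα θ₀ P _).2 ((integrable_and_integral_le_iff
    (hc.comp (continuous_const_mul _)).aestronglyMeasurable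
    (fun z => (inv_pos.2 (starVar_pos α _)).le) (by norm_num)).1 ⟨?_, hn.le⟩)
  exact hi.mono' (hc.comp (continuous_const_mul _)).aestronglyMeasurable
    (Eventually.of_forall (hdom n))

end

section

variable {J : ℕ}

/-! ### The equivalence theorem for the limit design -/

/-- The information of a design point at `θ₀ + x` divided by that of the limit design. -/
noncomputable def pointRelInfo (α : Fin J → ℝ) (θ₀ : ℝ) : DesignPoint J → ℝ → ℝ
  | .item τ, x => relInfo α θ₀ τ x
  | .star, _ => 1

lemma pointRelInfo_nonneg (α : Fin J → ℝ) (θ₀ : ℝ) (p : DesignPoint J) (x : ℝ) :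
    0 ≤ pointRelInfo α θ₀ p x := by
  cases p with
  | item τ => exact relInfo_nonneg α θ₀ τ x
  | star => exact zero_le_one

lemma continuous_pointRelInfo (α : Fin J → ℝ) (θ₀ : ℝ) (p : DesignPoint J) :
    Continuous (pointRelInfo α θ₀ p) := by
  cases p with
  | item τ => exact continuous_relInfo α θ₀ τ
  | star => exact continuous_const

variable [NeZero J]

lemma fisherInfo_pos {α : Fin J → ℝ} (hα : ∀ k, 0 < α k) (τ : Fin J → ℝ) (θ : ℝ) :
    0 < fisherInfo α τ θ := by
  refine (fisherInfo_nonneg α τ θ).lt_of_ne fun h => ?_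
  rw [fisherInfo_eq, centralMoment] at h
  have hz := (Finset.sum_eq_zero_iff_of_nonneg
    fun j _ => mul_nonneg (prob_pos α τ j θ).le (sq_nonneg _)).1 h.symm
  have hz' : ∀ j : Fin (J + 1), cumDisc α j = meanDisc α τ θ := fun j => by
    have := (mul_eq_zero.1 (hz j (Finset.mem_univ j))).resolve_left (prob_pos α τ j θ).ne'
    exact sub_eq_zero.1 (pow_eq_zero_iff two_ne_zero |>.1 this)
  have h1 := (hz' (Fin.last J)).trans (hz' 0).symm
  rw [Fin.val_last, cumDisc_last, Fin.val_zero, cumDisc_zero] at h1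
  exact (sum_pos_of_pos hα).ne' h1

lemma fisherInfoStar_pos {α : Fin J → ℝ} (hα : ∀ k, 0 < α k) (θ₀ θ : ℝ) :
    0 < fisherInfoStar α θ₀ θ := by
  rw [fisherInfoStar_eq hα]
  exact mul_pos (pow_pos (sum_pos_of_pos hα) 2) (starVar_pos α _)

lemma pointInfo_pos {α : Fin J → ℝ} (hα : ∀ k, 0 < α k) (θ₀ θ : ℝ) (p : DesignPoint J) :
    0 < pointInfo α θ₀ p θ := by
  cases p with
  | item τ => exact fisherInfo_pos hα τ θ
  | star => exact fisherInfoStar_pos hα θ₀ θ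

lemma designInfo_pos {α : Fin J → ℝ} (hα : ∀ k, 0 < α k) (θ₀ θ : ℝ) (η : Design J) :
    0 < designInfo α θ₀ η θ := by
  have hne : η.weight.support.Nonempty := by
    rw [Finsupp.support_nonempty_iff]
    intro h
    have := η.sum_one
    rw [h, Finsupp.sum_zero_index] at this
    exact zero_ne_one this
  exact Finset.sum_pos (fun p hp => mul_pos
    ((η.nonneg p).lt_of_ne (Finsupp.mem_support_iff.1 hp).symm) (pointInfo_pos hα θ₀ θ p)) hne

lemma designInfo_starDesign (α : Fin J → ℝ) (θ₀ θ : ℝ) :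
    designInfo α θ₀ (starDesign J) θ = fisherInfoStar α θ₀ θ := by
  simp [designInfo, starDesign, pointInfo]

lemma pointInfo_eq {α : Fin J → ℝ} (hα : ∀ k, 0 < α k) (θ₀ θ : ℝ) (p : DesignPoint J) :
    pointInfo α θ₀ p θ = pointRelInfo α θ₀ p (θ - θ₀) * fisherInfoStar α θ₀ θ := by
  cases p with
  | item τ =>
    have h := fisherInfo_eq_relInfo hα θ₀ (θ - θ₀) τ
    rwa [add_sub_cancel] at h
  | star => simp [pointInfo, pointRelInfo]

lemma continuous_fisherInfoStar {α : Fin J → ℝ} (hα : ∀ k, 0 < α k) (θ₀ : ℝ) :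
    Continuous (fisherInfoStar α θ₀) := by
  rw [funext (fisherInfoStar_eq hα θ₀)]
  exact continuous_const.mul ((continuous_starVar α).comp (continuous_sub_right θ₀))

/-- No design exceeds the limit design if no item does so in the directional derivative:
`log (M_η / M⋆) ≤ M_η / M⋆ - 1`, and the expectation of the right-hand side is at most `0`. -/
lemma psi0_le_of_lintegral_relInfo_le {α : Fin J → ℝ} (hα : ∀ k, 0 < α k) (θ₀ : ℝ)
    (μ : Measure ℝ) [IsProbabilityMeasure μ]
    (hi : Integrable (fun θ => Real.log (fisherInfoStar α θ₀ θ)) μ)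
    (h : ∀ τ, ∫⁻ θ, ENNReal.ofReal (relInfo α θ₀ τ (θ - θ₀)) ∂μ ≤ 1)
    (η : Design J) (hη : Integrable (fun θ => Real.log (designInfo α θ₀ η θ)) μ) :
    ∫ θ, Real.log (designInfo α θ₀ η θ) ∂μ ≤ ∫ θ, Real.log (fisherInfoStar α θ₀ θ) ∂μ := by
  set R : ℝ → ℝ := fun θ => η.weight.sum fun p w => w * pointRelInfo α θ₀ p (θ - θ₀) with hR
  have hcont : ∀ p, Continuous fun θ => pointRelInfo α θ₀ p (θ - θ₀) := fun p =>
    (continuous_pointRelInfo α θ₀ p).comp (continuous_sub_right θ₀)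
  have hRcont : Continuous R := continuous_finsetSum _ fun p _ => continuous_const.mul (hcont p)
  have hR0 : ∀ θ, 0 ≤ R θ := fun θ => Finset.sum_nonneg fun p _ =>
    mul_nonneg (η.nonneg p) (pointRelInfo_nonneg α θ₀ p _)
  have hM : ∀ θ, designInfo α θ₀ η θ = R θ * fisherInfoStar α θ₀ θ := fun θ => by
    simp only [designInfo, hR, Finsupp.sum, Finset.sum_mul, pointInfo_eq hα, mul_assoc]
  have hpt : ∀ p, ∫⁻ θ, ENNReal.ofReal (pointRelInfo α θ₀ p (θ - θ₀)) ∂μ ≤ 1 := fun p => by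
    cases p with
    | item τ => exact h τ
    | star => simp [pointRelInfo]
  have hlint : ∫⁻ θ, ENNReal.ofReal (R θ) ∂μ ≤ ENNReal.ofReal 1 := by
    have e : ∀ θ, ENNReal.ofReal (R θ) = ∑ p ∈ η.weight.support,
        ENNReal.ofReal (η.weight p) * ENNReal.ofReal (pointRelInfo α θ₀ p (θ - θ₀)) := fun θ => by
      rw [hR]
      simp only [Finsupp.sum]
      rw [ENNReal.ofReal_sum_of_nonneg fun p _ =>
        mul_nonneg (η.nonneg p) (pointRelInfo_nonneg α θ₀ p _)]
      exact Finset.sum_congr rfl fun p _ => ENNReal.ofReal_mul (η.nonneg p)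
    simp only [e]
    have hme : ∀ p, Measurable fun θ => ENNReal.ofReal (pointRelInfo α θ₀ p (θ - θ₀)) :=
      fun p => ENNReal.measurable_ofReal.comp (hcont p).measurable
    rw [lintegral_finsetSum _ fun p _ => (hme p).const_mul _]
    calc _ ≤ ∑ p ∈ η.weight.support, ENNReal.ofReal (η.weight p) := by
          refine Finset.sum_le_sum fun p _ => ?_
          rw [lintegral_const_mul _ (hme p)]
          exact mul_le_of_le_one_right' (hpt p)
      _ = ENNReal.ofReal 1 := by
          rw [← ENNReal.ofReal_sum_of_nonneg fun p _ => η.nonneg p]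
          exact congrArg _ η.sum_one
  obtain ⟨hRi, hRle⟩ := (integrable_and_integral_le_iff hRcont.aestronglyMeasurable hR0
    zero_le_one).2 hlint
  have hle : ∀ θ, Real.log (designInfo α θ₀ η θ) ≤
      Real.log (fisherInfoStar α θ₀ θ) + (R θ - 1) := fun θ => by
    have h1 := fisherInfoStar_pos hα θ₀ θ
    have h2 : 0 < R θ := pos_of_mul_pos_left (hM θ ▸ designInfo_pos hα θ₀ θ η) h1.le
    rw [hM, Real.log_mul h2.ne' h1.ne']
    linarith [Real.log_le_sub_one_of_pos h2]
  have hm := integral_mono hη (hi.add (hRi.sub (integrable_const 1))) hle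
  simp only [Pi.add_apply, Pi.sub_apply] at hm
  have hRi' : Integrable (fun θ => R θ - 1) μ := hRi.sub (integrable_const 1)
  rw [integral_add hi hRi', integral_sub hRi (integrable_const 1)] at hm
  simp only [integral_const, probReal_univ, one_smul] at hm
  linarith

/-- The design with weight `ε` on the item `τ` and weight `1 - ε` on the limit design. -/
noncomputable def mixDesign (τ : Fin J → ℝ) (ε : ℝ) (h0 : 0 ≤ ε) (h1 : ε ≤ 1) : Design J where
  weight := Finsupp.single .star (1 - ε) + Finsupp.single (.item τ) ε
  nonneg x := by
    classical
    rw [Finsupp.add_apply, Finsupp.single_apply, Finsupp.single_apply]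
    split_ifs <;> linarith
  sum_one := by
    rw [Finsupp.sum_add_index' (fun _ => rfl) (fun _ _ _ => rfl), Finsupp.sum_single_index rfl,
      Finsupp.sum_single_index rfl, sub_add_cancel]

lemma designInfo_mixDesign {α : Fin J → ℝ} (hα : ∀ k, 0 < α k) (θ₀ θ : ℝ) (τ : Fin J → ℝ) {ε : ℝ}
    (h0 : 0 ≤ ε) (h1 : ε ≤ 1) : designInfo α θ₀ (mixDesign τ ε h0 h1) θ =
      (1 - ε + ε * relInfo α θ₀ τ (θ - θ₀)) * fisherInfoStar α θ₀ θ := by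
  unfold designInfo mixDesign
  rw [Finsupp.sum_add_index' (fun _ => zero_mul _) (fun _ _ _ => add_mul _ _ _),
    Finsupp.sum_single_index (zero_mul _), Finsupp.sum_single_index (zero_mul _),
    pointInfo_eq hα, pointInfo_eq hα]
  simp only [pointRelInfo]
  ring

lemma integrable_log_mixDesign {α : Fin J → ℝ} (hα : ∀ k, 0 < α k) (θ₀ : ℝ)
    (μ : Measure ℝ) [IsProbabilityMeasure μ]
    (hi : Integrable (fun θ => Real.log (fisherInfoStar α θ₀ θ)) μ) (τ : Fin J → ℝ) {ε : ℝ}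
    (h0 : 0 ≤ ε) (h1 : ε < 1) :
    Integrable (fun θ => Real.log (designInfo α θ₀ (mixDesign τ ε h0 h1.le) θ)) μ := by
  have hcont : Continuous fun θ => designInfo α θ₀ (mixDesign τ ε h0 h1.le) θ := by
    simp only [designInfo_mixDesign hα]
    have h1 := (continuous_relInfo α θ₀ τ).comp (continuous_sub_right θ₀)
    exact (continuous_const.add (continuous_const.mul h1)).mul (continuous_fisherInfoStar hα θ₀)
  have hA := pow_pos (sum_pos_of_pos hα) 2
  refine ((hi.abs.add (integrable_const |Real.log (1 - ε)|)).add
    (integrable_const |Real.log ((∑ s, α s) ^ 2)|)).mono'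
    (hcont.log fun θ => (designInfo_pos hα θ₀ θ _).ne').aestronglyMeasurable
    (Eventually.of_forall fun θ => ?_)
  have hs := fisherInfoStar_pos hα θ₀ θ
  have hpos := designInfo_pos hα θ₀ θ (mixDesign τ ε h0 h1.le)
  have hlow : (1 - ε) * fisherInfoStar α θ₀ θ ≤ designInfo α θ₀ (mixDesign τ ε h0 h1.le) θ := by
    rw [designInfo_mixDesign hα]
    have := mul_nonneg h0 (relInfo_nonneg α θ₀ τ (θ - θ₀))
    exact mul_le_mul_of_nonneg_right (by linarith) hs.le
  have hup : designInfo α θ₀ (mixDesign τ ε h0 h1.le) θ ≤ (∑ s, α s) ^ 2 := by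
    have e : designInfo α θ₀ (mixDesign τ ε h0 h1.le) θ =
        (1 - ε) * fisherInfoStar α θ₀ θ + ε * fisherInfo α τ θ := by
      have := fisherInfo_eq_relInfo hα θ₀ (θ - θ₀) τ
      rw [add_sub_cancel] at this
      rw [designInfo_mixDesign hα, this]
      ring
    have hs1 : fisherInfoStar α θ₀ θ ≤ (∑ s, α s) ^ 2 := by
      rw [fisherInfoStar_eq hα]
      exact mul_le_of_le_one_right hA.le (by linarith [starVar_le α (θ - θ₀)])
    rw [e]
    nlinarith [fisherInfo_le hα τ θ]
  have h2 := Real.log_le_log (mul_pos (by linarith) hs) hlow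
  rw [Real.log_mul (by linarith) hs.ne'] at h2
  have h3 := Real.log_le_log hpos hup
  simp only [Pi.add_apply, Real.norm_eq_abs]
  rw [abs_le]
  constructor
  · linarith [neg_abs_le (Real.log (1 - ε)), neg_abs_le (Real.log (fisherInfoStar α θ₀ θ)),
      abs_nonneg (Real.log ((∑ s, α s) ^ 2))]
  · linarith [le_abs_self (Real.log ((∑ s, α s) ^ 2)), abs_nonneg (Real.log (1 - ε)),
      abs_nonneg (Real.log (fisherInfoStar α θ₀ θ))]

/-- If the mixture with weight `ε` does not beat the limit design, then the difference quotient
in the direction of `τ`, bounded below through `log y ≥ 1 - 1 / y`, has expectation at most `0`;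
it is shifted by `2` to be nonnegative. -/
lemma lintegral_quotient_le {α : Fin J → ℝ} (hα : ∀ k, 0 < α k) (θ₀ : ℝ)
    (μ : Measure ℝ) [IsProbabilityMeasure μ]
    (hopt : IsBayesOptimal0 α θ₀ μ (starDesign J)) (τ : Fin J → ℝ) {ε : ℝ}
    (h0 : 0 < ε) (h1 : ε ≤ 1 / 2) :
    ∫⁻ θ, ENNReal.ofReal ((relInfo α θ₀ τ (θ - θ₀) - 1) /
      (1 + ε * (relInfo α θ₀ τ (θ - θ₀) - 1)) + 2) ∂μ ≤ 2 := by
  set R : ℝ → ℝ := fun θ => relInfo α θ₀ τ (θ - θ₀) with hR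
  have hRc : Continuous R := (continuous_relInfo α θ₀ τ).comp (continuous_sub_right θ₀)
  have hR0 : ∀ θ, 0 ≤ R θ := fun θ => relInfo_nonneg α θ₀ τ _
  have hy : ∀ θ, 1 / 2 ≤ 1 + ε * (R θ - 1) := fun θ => by
    have := mul_nonneg h0.le (hR0 θ)
    linarith
  have hy0 : ∀ θ, 0 < 1 + ε * (R θ - 1) := fun θ => by linarith [hy θ]
  obtain ⟨hi, hle⟩ := hopt
  simp only [psi0, designInfo_starDesign] at hi hle
  have hmi := integrable_log_mixDesign hα θ₀ μ hi τ h0.le (show ε < 1 by linarith)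
  have hle := hle _ hmi
  have hlog : ∀ θ, Real.log (designInfo α θ₀ (mixDesign τ ε h0.le (by linarith)) θ) -
      Real.log (fisherInfoStar α θ₀ θ) = Real.log (1 + ε * (R θ - 1)) := fun θ => by
    rw [designInfo_mixDesign hα, show 1 - ε + ε * relInfo α θ₀ τ (θ - θ₀) =
      1 + ε * (R θ - 1) by rw [hR]; ring, Real.log_mul (hy0 θ).ne' (fisherInfoStar_pos hα θ₀ θ).ne',
      add_sub_cancel_right]
  have hli : Integrable (fun θ => Real.log (1 + ε * (R θ - 1))) μ := by
    simp only [← hlog]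
    exact hmi.sub hi
  have hlint : ∫ θ, Real.log (1 + ε * (R θ - 1)) ∂μ ≤ 0 := by
    simp only [← hlog]
    rw [integral_sub hmi hi]
    linarith
  have hgc : Continuous fun θ => (1 + ε * (R θ - 1))⁻¹ :=
    (by fun_prop : Continuous fun θ => 1 + ε * (R θ - 1)).inv₀ fun θ => (hy0 θ).ne'
  have hgi : Integrable (fun θ => (1 + ε * (R θ - 1))⁻¹) μ :=
    Integrable.of_bound hgc.aestronglyMeasurable 2 (Eventually.of_forall fun θ => by
      rw [Real.norm_of_nonneg (inv_pos.2 (hy0 θ)).le]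
      have := inv_anti₀ (by norm_num) (hy θ)
      norm_num at this ⊢
      exact this)
  have hgint : 1 - ∫ θ, (1 + ε * (R θ - 1))⁻¹ ∂μ ≤ 0 := by
    have hm := integral_mono ((integrable_const (1 : ℝ)).sub hgi) hli
      fun θ => Real.one_sub_inv_le_log_of_pos (hy0 θ)
    simp only [Pi.sub_apply] at hm
    rw [integral_sub (integrable_const _) hgi] at hm
    simp only [integral_const, probReal_univ, one_smul] at hm
    linarith
  have hq : ∀ θ, (R θ - 1) / (1 + ε * (R θ - 1)) + 2 =
      (ε⁻¹ + 2) - ε⁻¹ * (1 + ε * (R θ - 1))⁻¹ := fun θ => by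
    have hy1 := (hy0 θ).ne'
    have e : R θ - 1 = ε⁻¹ * (1 + ε * (R θ - 1) - 1) := by field_simp; ring
    generalize 1 + ε * (R θ - 1) = y at hy1 e
    rw [e]
    field_simp
    ring
  have hq0 : ∀ θ, 0 ≤ (R θ - 1) / (1 + ε * (R θ - 1)) + 2 := fun θ => by
    have : -2 ≤ (R θ - 1) / (1 + ε * (R θ - 1)) := by
      rw [le_div_iff₀ (hy0 θ)]
      have := mul_nonneg h0.le (hR0 θ)
      linarith [hR0 θ]
    linarith
  have hqi : Integrable (fun θ => (R θ - 1) / (1 + ε * (R θ - 1)) + 2) μ := by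
    simp only [hq]
    exact (integrable_const _).sub (hgi.const_mul _)
  have key := (integrable_and_integral_le_iff hqi.aestronglyMeasurable hq0
    (zero_le_two (α := ℝ))).1 ⟨hqi, by
      simp only [hq]
      rw [integral_sub (integrable_const _) (hgi.const_mul _), integral_const_mul]
      simp only [integral_const, probReal_univ, one_smul]
      have := mul_nonneg (inv_pos.2 h0).le (neg_nonneg.2 hgint)
      linarith⟩
  simpa using key

lemma lintegral_relInfo_le_one {α : Fin J → ℝ} (hα : ∀ k, 0 < α k) (θ₀ : ℝ)
    (μ : Measure ℝ) [IsProbabilityMeasure μ]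
    (hopt : IsBayesOptimal0 α θ₀ μ (starDesign J)) (τ : Fin J → ℝ) :
    ∫⁻ θ, ENNReal.ofReal (relInfo α θ₀ τ (θ - θ₀)) ∂μ ≤ 1 := by
  have hRc : Continuous fun θ => relInfo α θ₀ τ (θ - θ₀) :=
    (continuous_relInfo α θ₀ τ).comp (continuous_sub_right θ₀)
  have hm : ∀ n : ℕ, Measurable fun θ => ENNReal.ofReal ((relInfo α θ₀ τ (θ - θ₀) - 1) /
      (1 + 1 / ((n : ℝ) + 1) / 2 * (relInfo α θ₀ τ (θ - θ₀) - 1)) + 2) := fun n => by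
    have := hRc.measurable
    fun_prop
  have hlim : ∀ θ, Tendsto (fun n : ℕ => ENNReal.ofReal ((relInfo α θ₀ τ (θ - θ₀) - 1) /
      (1 + 1 / ((n : ℝ) + 1) / 2 * (relInfo α θ₀ τ (θ - θ₀) - 1)) + 2)) atTop
      (𝓝 (ENNReal.ofReal (relInfo α θ₀ τ (θ - θ₀)) + 1)) := fun θ => by
    set r := relInfo α θ₀ τ (θ - θ₀) with hr
    have h1 : Tendsto (fun n : ℕ => (r - 1) / (1 + 1 / ((n : ℝ) + 1) / 2 * (r - 1)) + 2) atTop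
        (𝓝 ((r - 1) / (1 + 0 / 2 * (r - 1)) + 2)) :=
      ((tendsto_const_nhds (x := r - 1)).div ((((tendsto_one_div_add_atTop_nhds_zero_nat
        (𝕜 := ℝ)).div_const 2).mul_const (r - 1)).const_add 1) (by norm_num)).add_const 2
    have h2 := (ENNReal.continuous_ofReal.tendsto _).comp h1
    rw [show (r - 1) / (1 + 0 / 2 * (r - 1)) + 2 = r + 1 by ring,
      ENNReal.ofReal_add (relInfo_nonneg α θ₀ τ _) zero_le_one, ENNReal.ofReal_one] at h2
    exact h2
  have key := lintegral_le_of_tendsto (μ := μ) hm hlim fun n =>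
    lintegral_quotient_le hα θ₀ μ hopt τ (half_pos Nat.one_div_pos_of_nat) (by
      have : 1 / ((n : ℝ) + 1) ≤ 1 := by
        rw [div_le_one (by positivity)]
        linarith [Nat.cast_nonneg (α := ℝ) n]
      linarith)
  rw [lintegral_add_right _ measurable_const, lintegral_one, measure_univ,
    ← one_add_one_eq_two] at key
  exact (ENNReal.add_le_add_iff_right ENNReal.one_ne_top).1 key

/-- The equivalence theorem: the limit design is optimal if and only if its criterion value is
finite and all directional derivatives towards single items are nonpositive. -/
lemma isBayesOptimal0_iff {α : Fin J → ℝ} (hα : ∀ k, 0 < α k) (θ₀ : ℝ)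
    (μ : Measure ℝ) [IsProbabilityMeasure μ] :
    IsBayesOptimal0 α θ₀ μ (starDesign J) ↔
      Integrable (fun θ => Real.log (fisherInfoStar α θ₀ θ)) μ ∧
        ∀ τ, ∫⁻ θ, ENNReal.ofReal (relInfo α θ₀ τ (θ - θ₀)) ∂μ ≤ 1 := by
  refine ⟨fun h => ⟨?_, lintegral_relInfo_le_one hα θ₀ μ h⟩, fun h => ⟨?_, fun η hη => ?_⟩⟩
  · simpa only [designInfo_starDesign] using h.1
  · simpa only [designInfo_starDesign] using h.1
  · simpa only [psi0, designInfo_starDesign] using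
      psi0_le_of_lintegral_relInfo_le hα θ₀ μ h.1 h.2 η hη

end

section

/-! ### Shifted limit designs -/

/-- The information of the limit design shifted by `t`, averaged over `x` and `-x`, relative
to the limit design itself, as a function of `C = cosh (A x)` and `T = cosh (A t)`. -/
noncomputable def shiftRel (T C : ℝ) : ℝ := (1 + C) * (1 + C * T) / (C + T) ^ 2

lemma div_add_div_eq_shiftRel (a b : ℝ) :
    (1 + Real.cosh a) / (1 + Real.cosh (a - b)) + (1 + Real.cosh a) / (1 + Real.cosh (a + b)) =
      2 * shiftRel (Real.cosh b) (Real.cosh a) := by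
  have h1 := Real.cosh_pos a
  have h2 := Real.cosh_pos b
  have h3 : 0 < 1 + Real.cosh (a - b) := by linarith [Real.cosh_pos (a - b)]
  have h4 : 0 < 1 + Real.cosh (a + b) := by linarith [Real.cosh_pos (a + b)]
  have hprod : (1 + Real.cosh (a - b)) * (1 + Real.cosh (a + b)) =
      (Real.cosh a + Real.cosh b) ^ 2 := by
    rw [Real.cosh_sub, Real.cosh_add]
    linear_combination (-(Real.sinh b ^ 2)) * Real.sinh_sq a +
      (1 - Real.cosh a ^ 2) * Real.sinh_sq b
  have hsum : Real.cosh (a - b) + Real.cosh (a + b) = 2 * Real.cosh a * Real.cosh b := by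
    rw [Real.cosh_sub, Real.cosh_add]
    ring
  rw [shiftRel, ← hprod]
  field_simp
  linear_combination hsum

lemma shiftRel_nonneg {T C : ℝ} (hT : 1 ≤ T) (hC : 1 ≤ C) : 0 ≤ shiftRel T C := by
  unfold shiftRel
  positivity

lemma le_shiftRel {T C : ℝ} (hT : 1 ≤ T) (hC : T ≤ C) : T / 4 ≤ shiftRel T C := by
  have hpos : 0 < C + T := by linarith
  rw [shiftRel, le_div_iff₀ (by positivity)]
  have h : (C + T) ^ 2 ≤ (2 * C) ^ 2 := pow_le_pow_left₀ (by linarith) (by linarith) 2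
  nlinarith

/-- A lower bound by the expansion at `T = 1`: the linear coefficient of `shiftRel T C - 1` in
`T - 1` is `1 - 3 / (1 + C)`, and the quadratic error is uniform in `C`. -/
lemma shiftRel_expansion {T C : ℝ} (hT : 1 ≤ T) (hC : 1 ≤ C) :
    (T - 1) * (1 - 3 / (1 + C)) ≤ shiftRel T C - 1 + 3 * (T - 1) ^ 2 := by
  have h1 : 0 < 1 + C := by linarith
  have h2 : 0 < C + T := by linarith
  have e : shiftRel T C - 1 + 3 * (T - 1) ^ 2 - (T - 1) * (1 - 3 / (1 + C)) =
      (T - 1) ^ 2 * (3 - (C ^ 2 - C - 2) / (1 + C) ^ 2 * ((2 * C + 1 + T) / (C + T) ^ 2) -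
        1 / (C + T) ^ 2) := by
    rw [shiftRel]
    field_simp
    ring
  have hb1 : (C ^ 2 - C - 2) / (1 + C) ^ 2 ≤ 1 := by
    rw [div_le_one (by positivity)]
    nlinarith
  have hb2 : (2 * C + 1 + T) / (C + T) ^ 2 ≤ 1 := by
    rw [div_le_one (by positivity)]
    nlinarith
  have hb3 : 1 / (C + T) ^ 2 ≤ 1 := by
    rw [div_le_one (by positivity)]
    nlinarith
  have hb4 : 0 ≤ (2 * C + 1 + T) / (C + T) ^ 2 := by positivity
  have : 0 ≤ (T - 1) ^ 2 * (3 - (C ^ 2 - C - 2) / (1 + C) ^ 2 * ((2 * C + 1 + T) / (C + T) ^ 2) -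
        1 / (C + T) ^ 2) := mul_nonneg (sq_nonneg _) (by nlinarith)
  linarith

variable {J : ℕ} [NeZero J]

lemma tendsto_relInfo_tauSeq {α : Fin J → ℝ} (hα : ∀ k, 0 < α k) (θ₀ t x : ℝ) :
    Tendsto (fun n : ℕ => relInfo α θ₀ (tauSeq α (θ₀ + t) n) x) atTop
      (𝓝 ((1 + Real.cosh ((∑ s, α s) * x)) / (1 + Real.cosh ((∑ s, α s) * (x - t))))) := by
  have h := ((tendsto_fisherInfo_tauSeq hα (θ₀ + t) (θ₀ + x)).comp
    tendsto_natCast_atTop_atTop).const_mul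
      (2 * (1 + Real.cosh ((∑ s, α s) * x)) / (∑ s, α s) ^ 2)
  have hA := (sum_pos_of_pos hα).ne'
  have hc := Real.cosh_pos ((∑ s, α s) * (x - t))
  have e : (1 + Real.cosh ((∑ s, α s) * x)) / (1 + Real.cosh ((∑ s, α s) * (x - t))) =
      2 * (1 + Real.cosh ((∑ s, α s) * x)) / (∑ s, α s) ^ 2 *
        ((∑ s, α s) ^ 2 * starVar α (θ₀ + x - (θ₀ + t))) := by
    rw [add_sub_add_left_eq_sub, starVar]
    field_simp
  rw [e]
  exact h

/-- The necessary conditions for optimality obtained from shifted copies of the limit design. -/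
lemma lintegral_shiftRel_le {α : Fin J → ℝ} (hα : ∀ k, 0 < α k) (θ₀ : ℝ) {P : Measure ℝ}
    (hP : P.map (fun z => -z) = P) {s : ℝ}
    (h : ∀ τ, ∫⁻ z, ENNReal.ofReal (relInfo α θ₀ τ (s * z)) ∂P ≤ 1) {T : ℝ} (hT : 1 ≤ T) :
    ∫⁻ z, ENNReal.ofReal (shiftRel T (Real.cosh ((∑ s, α s) * (s * z)))) ∂P ≤ 1 := by
  set A := ∑ s, α s with hA
  have hA0 : 0 < A := sum_pos_of_pos hα
  set t := Real.arcosh T / A with ht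
  have hTt : Real.cosh (A * t) = T := by
    rw [ht, mul_div_cancel₀ _ hA0.ne', Real.cosh_arcosh hT]
  set F : ℝ → ℝ := fun x => (1 + Real.cosh (A * x)) / (1 + Real.cosh (A * (x - t))) with hF
  have hc := Real.continuous_cosh
  have hFc : Continuous F := by
    refine Continuous.div (by fun_prop) (by fun_prop) fun x => ?_
    have := Real.cosh_pos (A * (x - t))
    positivity
  have hF0 : ∀ x, 0 ≤ F x := fun x => by
    have := Real.cosh_pos (A * (x - t))
    have := Real.cosh_pos (A * x)
    positivity
  have hF1 : ∫⁻ z, ENNReal.ofReal (F (s * z)) ∂P ≤ 1 :=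
    lintegral_le_of_tendsto
      (F := fun n z => ENNReal.ofReal (relInfo α θ₀ (tauSeq α (θ₀ + t) (n : ℕ)) (s * z)))
      (fun n => ENNReal.measurable_ofReal.comp
        ((continuous_relInfo α θ₀ _).comp (continuous_const_mul s)).measurable)
      (fun z => (ENNReal.continuous_ofReal.tendsto _).comp (tendsto_relInfo_tauSeq hα θ₀ t (s * z)))
      fun n => h _
  have hsymm : ∀ x, F x + F (-x) = 2 * shiftRel T (Real.cosh (A * x)) := fun x => by
    rw [← hTt, ← div_add_div_eq_shiftRel]
    simp only [hF]
    rw [mul_neg, Real.cosh_neg, ← Real.cosh_neg (A * (-x - t)),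
      show -(A * (-x - t)) = A * x + A * t by ring, mul_sub]
  have key := two_mul_lintegral hP hFc hF0 s
  simp only [hsymm] at key
  have hcS : Continuous fun z => shiftRel T (Real.cosh (A * (s * z))) := by
    unfold shiftRel
    refine Continuous.div (by fun_prop) (by fun_prop) fun z => ?_
    have := Real.cosh_pos (A * (s * z))
    positivity
  simp only [ENNReal.ofReal_mul (zero_le_two (α := ℝ))] at key
  have hmS : Measurable fun z => ENNReal.ofReal (shiftRel T (Real.cosh (A * (s * z)))) :=
    ENNReal.measurable_ofReal.comp hcS.measurable
  rw [lintegral_const_mul _ hmS,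
    ENNReal.ofReal_ofNat] at key
  rw [← (ENNReal.mul_right_inj two_ne_zero ENNReal.ofNat_ne_top).1 key]
  exact hF1

/-! ### The threshold of Bayes optimality -/

/-- `-log M⋆` grows linearly, so that the finiteness of the criterion value at the limit design
does not depend on the scale. -/
lemma integrable_log_starVar_iff {α : Fin J → ℝ} (hα : ∀ k, 0 < α k) {P : Measure ℝ}
    [IsProbabilityMeasure P] {s : ℝ} (hs : 0 < s) :
    Integrable (fun z => Real.log ((∑ s, α s) ^ 2 * starVar α (s * z))) P ↔
      Integrable (fun z => z) P := by
  set A := ∑ s, α s with hA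
  have hA0 : 0 < A := sum_pos_of_pos hα
  have hb : ∀ z, A * s * |z| ≤ -Real.log (starVar α (s * z)) ∧
      -Real.log (starVar α (s * z)) ≤ A * s * |z| + Real.log 4 := fun z => by
    rw [starVar, Real.log_inv, neg_neg, ← hA, ← Real.cosh_abs, abs_mul, abs_mul, abs_of_pos hA0,
      abs_of_pos hs, ← mul_assoc]
    set y := A * s * |z| with hy
    have hy0 : 0 ≤ y := by positivity
    have h1 := Real.exp_pos y
    have h2 := Real.exp_pos (-y)
    have h3 : Real.exp (-y) ≤ 1 := Real.exp_le_one_iff.2 (by linarith)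
    have h4 : 1 ≤ Real.exp y := Real.one_le_exp hy0
    have hce : 2 * (1 + Real.cosh y) = 2 + Real.exp y + Real.exp (-y) := by
      rw [Real.cosh_eq]; ring
    rw [hce]
    constructor
    · rw [Real.le_log_iff_exp_le (by positivity)]
      linarith
    · rw [← Real.log_exp y, ← Real.log_mul h1.ne' (by norm_num), Real.log_exp y]
      exact Real.log_le_log (by positivity) (by linarith)
  have hsplit : ∀ z, Real.log (A ^ 2 * starVar α (s * z)) =
      Real.log (A ^ 2) - -Real.log (starVar α (s * z)) := fun z => by
    rw [Real.log_mul (by positivity) (starVar_pos α _).ne']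
    ring
  have hVc : Continuous fun z => starVar α (s * z) :=
    (continuous_starVar α).comp (continuous_const_mul s)
  have hc : Continuous fun z => Real.log (A ^ 2 * starVar α (s * z)) :=
    (continuous_const.mul hVc).log fun z => (mul_pos (by positivity) (starVar_pos α _)).ne'
  constructor
  · intro h
    refine (((integrable_const |Real.log (A ^ 2)|).add h.abs).const_mul (A * s)⁻¹).mono'
      aestronglyMeasurable_id (Eventually.of_forall fun z => ?_)
    simp only [Pi.add_apply, Real.norm_eq_abs]
    rw [inv_mul_eq_div, le_div_iff₀ (by positivity), hsplit]
    have := neg_abs_le (Real.log (A ^ 2) - -Real.log (starVar α (s * z)))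
    linarith [(hb z).1, le_abs_self (Real.log (A ^ 2))]
  · intro h
    refine ((integrable_const (|Real.log (A ^ 2)| + Real.log 4)).add
      (h.abs.const_mul (A * s))).mono' hc.aestronglyMeasurable (Eventually.of_forall fun z => ?_)
    simp only [Pi.add_apply, Real.norm_eq_abs]
    rw [hsplit]
    refine (abs_sub _ _).trans ?_
    have h0 : 0 ≤ A * s * |z| := by positivity
    rw [abs_of_nonneg (h0.trans (hb z).1)]
    linarith [(hb z).2]

lemma isBayesOptimal0_scaleFamily_iff {α : Fin J → ℝ} (hα : ∀ k, 0 < α k) (θ₀ : ℝ) (P : Measure ℝ)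
    [IsProbabilityMeasure P] {s : ℝ} (hs : 0 < s) :
    IsBayesOptimal0 α θ₀ (scaleFamily P θ₀ s) (starDesign J) ↔ Integrable (fun z => z) P ∧
      ∀ τ, ∫⁻ z, ENNReal.ofReal (relInfo α θ₀ τ (s * z)) ∂P ≤ 1 := by
  have := isProbabilityMeasure_scaleFamily P θ₀ s
  have hlc : Continuous fun x => Real.log ((∑ s, α s) ^ 2 * starVar α x) :=
    (continuous_const.mul (continuous_starVar α)).log fun x =>
      (mul_pos (pow_pos (sum_pos_of_pos hα) 2) (starVar_pos α x)).ne'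
  rw [isBayesOptimal0_iff hα]
  simp only [fisherInfoStar_eq hα]
  rw [integrable_scaleFamily P θ₀ s hlc, integrable_log_starVar_iff hα hs]
  refine and_congr_right fun _ => forall_congr' fun τ => ?_
  rw [lintegral_scaleFamily P θ₀ s (F := fun x => ENNReal.ofReal (relInfo α θ₀ τ x))
    (ENNReal.measurable_ofReal.comp (continuous_relInfo α θ₀ τ).measurable)]

lemma exists_isThreshold_isBayesOptimal0 {α : Fin J → ℝ} (hα : ∀ k, 0 < α k) (θ₀ : ℝ)
    {P : Measure ℝ} [IsProbabilityMeasure P] (hP : P.map (fun z => -z) = P) :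
    ∃ x, IsThreshold
      (fun s => IsBayesOptimal0 α θ₀ (scaleFamily P θ₀ s) (starDesign J)) x := by
  refine exists_isThreshold (fun s s' hs' hle h => ?_) fun s hs h => ?_
  · rw [isBayesOptimal0_scaleFamily_iff hα θ₀ P (hs'.trans_le hle)] at h
    rw [isBayesOptimal0_scaleFamily_iff hα θ₀ P hs']
    exact ⟨h.1, fun τ => (lintegral_scale_mono hP (continuous_relInfo α θ₀ τ)
      (relInfo_nonneg α θ₀ τ) (monotoneOn_relInfo_symm hα θ₀ τ) hs' hle).trans (h.2 τ)⟩
  · have h' := fun s' hs' hlt => (isBayesOptimal0_scaleFamily_iff hα θ₀ P hs').1 (h s' hs' hlt)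
    exact (isBayesOptimal0_scaleFamily_iff hα θ₀ P hs).2
      ⟨(h' (s / 2) (half_pos hs) (half_lt_self hs)).1, fun τ =>
        lintegral_scale_closed (continuous_relInfo α θ₀ τ) hs fun s' hs' hlt => (h' s' hs' hlt).2 τ⟩

lemma necessaryCond0_of_isBayesOptimal0 {α : Fin J → ℝ} (hα : ∀ k, 0 < α k) (θ₀ : ℝ)
    {P : Measure ℝ} [IsProbabilityMeasure P] (hP : P.map (fun z => -z) = P) {s : ℝ} (hs : 0 < s)
    (h : IsBayesOptimal0 α θ₀ (scaleFamily P θ₀ s) (starDesign J)) :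
    NecessaryCond0 α θ₀ (scaleFamily P θ₀ s) := by
  rw [necessaryCond0_iff hα]
  have hopt := ((isBayesOptimal0_scaleFamily_iff hα θ₀ P hs).1 h).2
  have hV := integrable_starVar α P s
  have key : ∀ T : ℝ, 1 < T → 1 - 6 * ∫ z, starVar α (s * z) ∂P ≤ 3 * (T - 1) := fun T hT => by
    have hle := lintegral_shiftRel_le hα θ₀ hP hopt hT.le
    rw [← ENNReal.ofReal_one] at hle
    have hcosh := Real.continuous_cosh
    have hc : Continuous fun z => shiftRel T (Real.cosh ((∑ s, α s) * (s * z))) := by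
      unfold shiftRel
      refine Continuous.div (by fun_prop) (by fun_prop) fun z => ?_
      have := Real.cosh_pos ((∑ s, α s) * (s * z))
      positivity
    obtain ⟨hi, hle⟩ := (integrable_and_integral_le_iff hc.aestronglyMeasurable
      (fun z => shiftRel_nonneg hT.le (Real.one_le_cosh _)) zero_le_one).2 hle
    have hpt : ∀ z, (T - 1) * (1 - 6 * starVar α (s * z)) ≤
        shiftRel T (Real.cosh ((∑ s, α s) * (s * z))) + (3 * (T - 1) ^ 2 - 1) := fun z => by
      have h1 := shiftRel_expansion hT.le (Real.one_le_cosh ((∑ s, α s) * (s * z)))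
      have e : 3 / (1 + Real.cosh ((∑ s, α s) * (s * z))) = 6 * starVar α (s * z) := by
        have := Real.cosh_pos ((∑ s, α s) * (s * z))
        rw [starVar]
        field_simp
        norm_num
      rw [e] at h1
      linarith
    have hm := integral_mono (((integrable_const (1 : ℝ)).sub (hV.const_mul 6)).const_mul (T - 1))
      (hi.add (integrable_const (3 * (T - 1) ^ 2 - 1))) hpt
    simp only [Pi.add_apply, Pi.sub_apply] at hm
    rw [integral_const_mul, integral_sub (integrable_const _) (hV.const_mul 6), integral_const_mul,
      integral_add hi (integrable_const _)] at hm
    simp only [integral_const, probReal_univ, one_smul] at hm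
    refine le_of_mul_le_mul_left ?_ (sub_pos.2 hT)
    linarith
  have : 1 - 6 * ∫ z, starVar α (s * z) ∂P ≤ 0 := le_of_forall_pos_le_add fun ε hε => by
    have := key (1 + ε / 3) (by linarith)
    linarith
  linarith

lemma exists_measure_abs_ge_pos {P : Measure ℝ} [IsProbabilityMeasure P]
    (hP : P ≠ Measure.dirac 0) : ∃ δ : ℝ, 0 < δ ∧ 0 < P {z | δ ≤ |z|} := by
  by_contra! h
  refine hP ?_
  have hU : {z : ℝ | z ≠ 0} ⊆ ⋃ n : ℕ, {z | 1 / ((n : ℝ) + 1) ≤ |z|} := fun z hz => by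
    obtain ⟨n, hn⟩ := exists_nat_one_div_lt (abs_pos.2 hz)
    exact Set.mem_iUnion.2 ⟨n, hn.le⟩
  have h0 : P {z : ℝ | z ≠ 0} = 0 := measure_mono_null hU
    (measure_iUnion_null fun n => le_antisymm (h _ Nat.one_div_pos_of_nat) bot_le)
  have hae : (fun z : ℝ => z) =ᵐ[P] fun _ => 0 := h0
  have hmap := Measure.map_congr (mβ := inferInstance) hae
  rwa [Measure.map_id', Measure.map_const, measure_univ, one_smul] at hmap

lemma exists_not_isBayesOptimal0 {α : Fin J → ℝ} (hα : ∀ k, 0 < α k) (θ₀ : ℝ)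
    {P : Measure ℝ} [IsProbabilityMeasure P] (hP : P.map (fun z => -z) = P)
    (hne : P ≠ Measure.dirac 0) :
    ∃ s, 0 < s ∧ ¬ IsBayesOptimal0 α θ₀ (scaleFamily P θ₀ s) (starDesign J) := by
  obtain ⟨δ, hδ, hpos⟩ := exists_measure_abs_ge_pos hne
  set p := (P {z | δ ≤ |z|}).toReal with hp
  have hp0 : 0 < p := ENNReal.toReal_pos hpos.ne' (measure_ne_top _ _)
  have hp1 : p ≤ 1 := prob_le_one |> ENNReal.toReal_mono ENNReal.one_ne_top |>.trans_eq (by simp)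
  have hA0 := sum_pos_of_pos hα
  -- the shift with `T = 8 / p` has relative information at least `2 / p` on an event of
  -- probability `p` as soon as `cosh (A s δ) ≥ T`
  set T := 8 / p with hT
  have hT1 : 1 ≤ T := by
    rw [hT, le_div_iff₀ hp0]
    linarith
  have ha := Real.arcosh_pos (show 1 < T by rw [hT, lt_div_iff₀ hp0]; linarith)
  refine ⟨Real.arcosh T / ((∑ s, α s) * δ), by positivity, fun h => ?_⟩
  rw [isBayesOptimal0_scaleFamily_iff hα θ₀ P (by positivity)] at h
  have hle := lintegral_shiftRel_le hα θ₀ hP h.2 hT1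
  set s := Real.arcosh T / ((∑ s, α s) * δ) with hs
  have hs0 : 0 < s := by positivity
  have hmeas : MeasurableSet {z : ℝ | δ ≤ |z|} := measurableSet_le measurable_const measurable_id.abs
  have hlow : ENNReal.ofReal (T / 4) * P {z | δ ≤ |z|} ≤
      ∫⁻ z, ENNReal.ofReal (shiftRel T (Real.cosh ((∑ s, α s) * (s * z)))) ∂P := by
    rw [← lintegral_indicator_const hmeas]
    refine lintegral_mono (Set.indicator_le fun z hz => ?_)
    refine ENNReal.ofReal_le_ofReal (le_shiftRel hT1 ?_)
    rw [← Real.cosh_arcosh hT1, Real.cosh_le_cosh, abs_of_pos ha, abs_mul, abs_mul,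
      abs_of_pos hA0, abs_of_pos hs0]
    calc Real.arcosh T = (∑ s, α s) * (s * δ) := by rw [hs]; field_simp
      _ ≤ (∑ s, α s) * (s * |z|) := by gcongr; exact hz
  have h2 := hlow.trans hle
  rw [← ENNReal.ofReal_toReal (measure_ne_top P {z | δ ≤ |z|}), ← hp,
    ← ENNReal.ofReal_mul (by positivity), ENNReal.ofReal_le_one, hT] at h2
  have e : 8 / p / 4 * p = 2 := by
    field_simp
    norm_num
  linarith

end

end GPCM

open GPCM
theorem theorem3 {J : ℕ} [NeZero J] (α : Fin J → ℝ) (hα : ∀ k, 0 < α k) (θ₀ : ℝ)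
    (P : Measure ℝ) [IsProbabilityMeasure P] (hP : P.map (fun z => -z) = P) :
    ∃ sM1 s0 t0 : ℝ≥0∞,
      -- the threshold of the necessary condition for `ψ_{-1}`, and its uniqueness
      (IsThreshold (fun s => NecessaryCondM1 α θ₀ (scaleFamily P θ₀ s)) sM1 ∧
        ∀ x, IsThreshold (fun s => NecessaryCondM1 α θ₀ (scaleFamily P θ₀ s)) x → x = sM1) ∧
      -- the threshold of the necessary condition for `ψ_0`, and its uniqueness
      (IsThreshold (fun s => NecessaryCond0 α θ₀ (scaleFamily P θ₀ s)) s0 ∧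
        ∀ x, IsThreshold (fun s => NecessaryCond0 α θ₀ (scaleFamily P θ₀ s)) x → x = s0) ∧
      -- `0 < s_{-1}` as soon as `ψ_{-1}(τ*)` is finite for some scale
      ((∃ s : ℝ, 0 < s ∧ Integrable (fun θ => (designInfo α θ₀ (starDesign J) θ)⁻¹)
        (scaleFamily P θ₀ s)) → 0 < sM1) ∧
      sM1 ≤ s0 ∧ 0 < s0 ∧
      -- the threshold of Bayes optimality for `ψ_0`, and its uniqueness
      (IsThreshold (fun s => IsBayesOptimal0 α θ₀ (scaleFamily P θ₀ s) (starDesign J)) t0 ∧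
        ∀ x, IsThreshold
          (fun s => IsBayesOptimal0 α θ₀ (scaleFamily P θ₀ s) (starDesign J)) x → x = t0) ∧
      t0 ≤ s0 ∧ (P ≠ Measure.dirac 0 → t0 < ∞) := by
  obtain ⟨sM1, hM1⟩ := exists_isThreshold_necessaryCondM1 hα θ₀ hP
  obtain ⟨s0, h0⟩ := exists_isThreshold_necessaryCond0 hα θ₀ hP
  obtain ⟨t0, ht⟩ := exists_isThreshold_isBayesOptimal0 hα θ₀ hP
  refine ⟨sM1, s0, t0, ⟨hM1, fun x hx => hM1.unique hx⟩, ⟨h0, fun x hx => h0.unique hx⟩, ?_,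
    hM1.le_of_imp h0 fun s _ h => h.necessaryCond0 hα, ?_, ⟨ht, fun x hx => ht.unique hx⟩,
    ht.le_of_imp h0 fun s hs h => necessaryCond0_of_isBayesOptimal0 hα θ₀ hP hs h, fun hne => ?_⟩
  · rintro ⟨s, hs, hi⟩
    have hA := pow_pos (sum_pos_of_pos hα) 2
    simp only [designInfo_starDesign, fisherInfoStar_eq hα, mul_inv] at hi
    rw [integrable_const_mul_iff (IsUnit.mk0 _ (inv_pos.2 hA).ne'),
      integrable_scaleFamily P θ₀ s (continuous_inv_starVar α)] at hi
    obtain ⟨s', hs', h'⟩ := exists_necessaryCondM1 hα θ₀ P hs hi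
    exact hM1.pos hs' h'
  · obtain ⟨s, hs, h⟩ := exists_necessaryCond0 hα θ₀ P
    exact h0.pos hs h
  · obtain ⟨s, hs, h⟩ := exists_not_isBayesOptimal0 hα θ₀ hP hne
    exact ht.lt_top hs h
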